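/- **Setting.** Let $D\subseteq\mathbb R$, let $\rho$ be a probability measure on $D$, $\mu=\bigotimes_{n\in\mathbb N}\rho$, and let $\mathcal U$ be the set of finite subsets of $\mathbb N$. Let $k\neq 0$ be a measurable reproducing kernel on $D\times D$ with $H(k)\cap H(1)=\{0\}$ (the only constant function in $H(k)$ is $0$), $M:=\int_D k(x,x)\,\rho(dx)<\infty$, $\int_D k(x,y)\,\rho(dx)=0$ for all $y\in D$, and $k(x,x)>0$ for all $x\in D$. Let $(\gamma_u)_{u\in\mathcal U}$ be non-negative weights with $\gamma_\emptyset=1$ and $\sum_u\gamma_uM^{|u|}<\infty$. Put $k_u(\mathbf x,\mathbf y)=\prod_{j\in u}k(x_j,y_j)$, $H_u=H(k_u)$, $\mathfrak X=\{\mathbf x\in D^{\mathbb N}:\sum_u\gamma_uk_u(\mathbf x,\mathbf x)<\infty\}$, $K=\sum_u\gamma_uk_u$ on $\mathfrak X\times\mathfrak X$; let $B(K)$ be the unit ball of the reproducing kernel Hilbert space $H(K)$ and $I(f)=\int_{\mathfrak X}f\,d\mu$. Functions in $H(K)$ are extended by $0$ to $D^{\mathbb N}$. Let $\gamma$ be finite-intersection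 weights of finite order $\omega$, i.e. $\gamma_u=0$ if $|u|>\omega$ and there is $r\in\mathbb N$ such that every $u$ with $\gamma_u>0$ meets at most $1+r$ sets $v$ with $\gamma_v>0$; let $\eta\in\mathbb N$ be such that each $j\in\mathbb N$ lies in at most $\eta$ sets $u$ with $\gamma_u>0$, and put $d=\eta(\omega-1)+1$. Let $a\in D$ with $\sum_u\gamma_uk(a,a)^{|u|}<\infty$, $\mathbf a=(a,a,\dots)$ and $\widehat\gamma_u=\gamma_uk_u(\mathbf a,\mathbf a)$. Assume that infinitely many $\gamma_u$ are positive, and let $u_1,u_2,\dots$ be an ordering of all non-empty $u$ with $\gamma_u>0$ such that $\widehat\gamma_{u_1}\ge\widehat\gamma_{u_2}\ge\cdots$. Let $$\mathrm{decay}_\gamma=\sup\{p\in\mathbb R:\lim_{j\to\infty}\widehat\gamma_{u_j}j^p=0\}\in[1,\infty].$$ Let $\$:\mathbb N\cup\{0\}\to[0,\infty)$ be increasing with $\$(\nu)=O(\nu^s)$ for some $s>0$. In the fixed subspace sampling model a function evaluation costs $\$(|v|)$ at points $\mathbf x$ with $x_j=a$ for all $j\notin v$, and $\infty$ at other points; the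 cost of a randomized algorithm is the expected sum of the costs of its function evaluations. The randomized error of $Q$ is $e(Q,B(K))=\big(\sup_{f\in B(K)}\mathbb E(I(f)-Q(f))^2\big)^{1/2}$. **Finite-dimensional rules.** Let $(\Omega,\Sigma,\mathbb P)$ be a probability space and $\alpha,\beta,C_d\in\mathbb R$. Consider randomized linear rules $Q_n(\omega,f)=\sum_{i=1}^nw_if(\mathbf x^{(i)}(\omega))$, $n\in\mathbb N$, $\omega\in\Omega^d$, $\mathbf x^{(i)}(\omega)\in D^d$, with deterministic coefficients $w_i=w_i^{(n)}$ and random points $\mathbf x^{(i)}$ (also depending on $n$), such that $\sum_iw_i=1$, each component $x^{(i)}_j$ depends only on $\omega_j$ and is a random variable with law $\rho$, and $$\mathrm{Var}(Q_n(f_u))\le C_dn^{-\alpha}\ln(n)^\beta\|f_u\|_{k_u}^2\qquad\text{for all }n\ge2,\ u\subseteq[d],\ f_u\in H_u .$$ **Replicated rules.** There is a map $\varphi:\mathbb N\to[d]$ that is injective on every $u$ with $\gamma_u>0$. Given such a $\varphi$ and $L,n\in\mathbb N$, put $v=u_1\cup\dots\cup u_L$ and let $$Q_{v,\mathbf a}(f)=\sum_{i=1}^nw_if(\mathbf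 t^{(i)}_v;\mathbf a),\qquad t^{(i)}_{\nu}=x^{(i)}_{\varphi(\nu)}\ \ (\nu\in v),$$ be the single-level algorithm built from $Q_n$, where $(\mathbf t_v;\mathbf a)$ has components $t_\nu$ for $\nu\in v$ and $a$ otherwise. **Theorem.** For every $0<\delta<\alpha$ there are a constant $C$, a number $N_0$ and sample sizes $n(L)\in\mathbb N$, $L\in\mathbb N$, which do not depend on the choice of rules $Q_n$ as above nor on $\varphi$, such that the following holds for the single-level algorithms $Q_L=Q_{v,\mathbf a}$ with $v=u_1\cup\dots\cup u_L$ and $n=n(L)$. With $$x=\frac{(\alpha-\delta)(\mathrm{decay}_\gamma-1)}{(\alpha-\delta)s+\mathrm{decay}_\gamma-1}$$ (to be read as $\alpha-\delta$ if $\mathrm{decay}_\gamma=\infty$) one has: 1. for every $L\ge1$, if $N$ is the cost of $Q_L$, then $e(Q_L,B(K))^2\le C\,N^{-x}$ (with $0^{-x}=\infty$ if $x>0$); 2. for every $N\ge N_0$ there is an $L\ge1$ such that $Q_L$ has cost at most $N$ and $e(Q_L,B(K))^2\le C\,N^{-x}$. -/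

import Mathlib

open MeasureTheory ProbabilityTheory Filter Topology
open scoped ENNReal NNReal

noncomputable section

namespace InfDimIntegration

/-! ### Reproducing kernels and their Hilbert spaces -/

/-- A real reproducing kernel on `X`: a symmetric, positive semidefinite function on `X × X`. -/
class IsReproducingKernel {X : Type*} (K : X → X → ℝ) : Prop where
  posSemidef : (Matrix.of K).PosSemidef

/-- A real kernel, written as an operator-valued kernel for Mathlib's `RKHS` library. -/
def kernelMatrix {X : Type*} (K : X → X → ℝ) : Matrix X X (ℝ →L[ℝ] ℝ) :=
  Matrix.of fun x y => K x y • ContinuousLinearMap.id ℝ ℝ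

theorem IsReproducingKernel.symm {X : Type*} {K : X → X → ℝ} (h : IsReproducingKernel K)
    (x y : X) : K x y = K y x := by
  have := h.posSemidef.isHermitian.apply y x
  simpa using this

theorem IsReproducingKernel.sum_nonneg {X : Type*} {K : X → X → ℝ} (h : IsReproducingKernel K)
    (c : X →₀ ℝ) : 0 ≤ c.sum fun x a => c.sum fun y b => a * K x y * b := by
  simpa using h.posSemidef.2 c

theorem IsReproducingKernel.of {X : Type*} {K : X → X → ℝ} (h : ∀ x y, K x y = K y x)
    (h' : ∀ c : X →₀ ℝ, 0 ≤ c.sum fun x a => c.sum fun y b => a * K x y * b) :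
    IsReproducingKernel K := by
  refine ⟨⟨?_, fun c => ?_⟩⟩
  · ext x y
    simpa using h y x
  · simpa using h' c

/-- Products of positive semidefinite kernels are positive semidefinite. -/
theorem IsReproducingKernel.mul {X : Type*} {K L : X → X → ℝ} (hK : IsReproducingKernel K)
    (hL : IsReproducingKernel L) : IsReproducingKernel fun x y => K x y * L x y := by
  refine ⟨?_⟩
  have h := Matrix.PosSemidef.hadamard (𝕜 := ℝ) hK.posSemidef hL.posSemidef
  exact h

theorem IsReproducingKernel.diag_nonneg {X : Type*} {K : X → X → ℝ} (h : IsReproducingKernel K)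
    (x : X) : 0 ≤ K x x := by
  simpa using h.posSemidef.diag_nonneg (i := x)

theorem IsReproducingKernel.abs_le_diag {X : Type*} {K : X → X → ℝ} (h : IsReproducingKernel K)
    (x y : X) : |K x y| ≤ K x x + K y y := by
  classical
  have hx := h.diag_nonneg x
  have hy := h.diag_nonneg y
  have hs := h.symm x y
  have key : ∀ t : ℝ, 0 ≤ K x x + t * K x y + t * K y x + t * t * K y y := by
    intro t
    have h0 := h.sum_nonneg (Finsupp.single x 1 + Finsupp.single y t)
    rw [Finsupp.sum_add_index' (by simp)
      (by intros; simp [Finsupp.sum, add_mul, Finset.sum_add_distrib])] at h0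
    rw [Finsupp.sum_single_index (by simp), Finsupp.sum_single_index (by simp)] at h0
    rw [Finsupp.sum_add_index' (by simp) (by intros; ring),
      Finsupp.sum_add_index' (by simp) (by intros; ring)] at h0
    simp only [Finsupp.sum_single_index, mul_zero] at h0
    nlinarith [h0]
  have h1 := key 1
  have h2 := key (-1)
  rw [_root_.abs_le]
  constructor <;> nlinarith

instance kernelMatrix_posSemidef {X : Type*} (K : X → X → ℝ) [h : IsReproducingKernel K] :
    Fact (kernelMatrix K).PosSemidef := by
  have tfae := (RKHS.posSemidef_tfae (K := kernelMatrix K)).out 0 2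
  refine ⟨tfae.mpr ⟨?_, fun c => ?_⟩⟩
  · ext x y
    simp [kernelMatrix, h.symm x y, Matrix.conjTranspose, Matrix.transpose, Matrix.map]
    change K y x * (star (1 : ℝ →L[ℝ] ℝ)) 1 = K y x
    simp
  · have := h.sum_nonneg c
    simp only [kernelMatrix, Matrix.of_apply, RCLike.re_to_real]
    refine this.trans_eq ?_
    refine Finsupp.sum_congr fun x _ => Finsupp.sum_congr fun y _ => ?_
    simp [h.symm y x]
    ring

/-- `H(K)`, the reproducing kernel Hilbert space with kernel `K`. Its elements coerce to
functions `X → ℝ`. -/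
abbrev RKSpace {X : Type*} (K : X → X → ℝ) [IsReproducingKernel K] : Type _ :=
  RKHS.OfKernel (kernelMatrix K)

/-- `B(K)`, the norm unit ball of `H(K)`, as a set of functions on `X`. -/
def unitBall {X : Type*} (K : X → X → ℝ) [IsReproducingKernel K] : Set (X → ℝ) :=
  {g | ∃ f : RKSpace K, ‖f‖ ≤ 1 ∧ g = ⇑f}

/-- The product kernel `k_u(x, y) = ∏_{j ∈ u} k(x_j, y_j)`. -/
def prodKernel {ι D : Type*} (k : D → D → ℝ) (u : Finset ι) (x y : ι → D) : ℝ :=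
  ∏ j ∈ u, k (x j) (y j)

instance prodKernel_isReproducingKernel {ι D : Type*} (k : D → D → ℝ)
    [h : IsReproducingKernel k] (u : Finset ι) : IsReproducingKernel (prodKernel k u) := by
  classical
  induction u using Finset.induction_on with
  | empty =>
    refine IsReproducingKernel.of (by simp [prodKernel]) fun c => ?_
    have : (c.sum fun x a => c.sum fun y b => a * prodKernel k ∅ x y * b)
        = (c.sum fun _ a => a) * (c.sum fun _ a => a) := by
      simp [prodKernel, Finsupp.sum, Finset.sum_mul_sum]
    rw [this]
    exact mul_self_nonneg _
  | insert j u hj ih =>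
    have h1 : IsReproducingKernel fun x y : ι → D => k (x j) (y j) :=
      ⟨h.posSemidef.submatrix (fun x : ι → D => x j)⟩
    have h2 := h1.mul ih
    have h3 : prodKernel k (insert j u) = fun x y => k (x j) (y j) * prodKernel k u x y := by
      funext x y
      simp [prodKernel, Finset.prod_insert hj]
    rw [h3]
    exact h2

/-! ### Weights -/

/-- Finite-order weights of order `o`. -/
def HasFiniteOrder (γ : Finset ℕ → ℝ≥0) (o : ℕ) : Prop :=
  ∀ u : Finset ℕ, o < u.card → γ u = 0

/-- Finite-intersection weights: finite-order weights for which there is an `r` such that every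
active set (i.e. set of positive weight) meets at most `1 + r` active sets. -/
def IsFiniteIntersection (γ : Finset ℕ → ℝ≥0) : Prop :=
  (∃ o, HasFiniteOrder γ o) ∧
    ∃ r : ℕ, ∀ u, 0 < γ u → {v | 0 < γ v ∧ (u ∩ v).Nonempty}.encard ≤ 1 + (r : ℕ∞)

/-- Every coordinate belongs to at most `η` active sets. -/
def HasCoordinateBound (γ : Finset ℕ → ℝ≥0) (η : ℕ) : Prop :=
  ∀ j : ℕ, {u | 0 < γ u ∧ j ∈ u}.encard ≤ (η : ℕ∞)

/-- `γ̂_u = γ_u k_u(𝐚, 𝐚)` for the anchor `𝐚 = (a, a, …)`. -/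
def hatWeight {D : Type*} (γ : Finset ℕ → ℝ≥0) (k : D → D → ℝ) (a : D) (u : Finset ℕ) : ℝ :=
  γ u * prodKernel k u (fun _ => a) (fun _ => a)

/-- `u 0, u 1, …` is an ordering `u₁, u₂, …` (the index is shifted by one) of the nonempty active
sets along which `γ̂` is decreasing. -/
structure IsWeightOrdering {D : Type*} (γ : Finset ℕ → ℝ≥0) (k : D → D → ℝ) (a : D)
    (u : ℕ → Finset ℕ) : Prop where
  injective : Function.Injective u
  range_eq : Set.range u = {v | v.Nonempty ∧ 0 < γ v}
  antitone : Antitone fun j => hatWeight γ k a (u j)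

/-- `decay_γ = sup {p ∈ ℝ | γ̂_{u_j} j^p → 0}`, as an extended real number. -/
def decay {D : Type*} (γ : Finset ℕ → ℝ≥0) (k : D → D → ℝ) (a : D) (u : ℕ → Finset ℕ) : EReal :=
  sSup ((fun p : ℝ => (p : EReal)) ''
    {p | Tendsto (fun j : ℕ => hatWeight γ k a (u j) * ((j : ℝ) + 1) ^ p) atTop (𝓝 0)})

/-- The exponent `t (q - 1) / (t s + q - 1)`, understood as its limit `t` for `q = ∞`. -/
def rateExponent (t s : ℝ) (q : EReal) : ℝ :=
  if q = ⊤ then t else t * (q.toReal - 1) / (t * s + q.toReal - 1)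

/-! ### Functions of infinitely many variables -/

/-- The domain `𝔛 = {x ∈ D^ℕ | ∑_u γ_u k_u(x, x) < ∞}`. -/
def domain {D : Type*} (γ : Finset ℕ → ℝ≥0) (k : D → D → ℝ) : Set (ℕ → D) :=
  {x | Summable fun u : Finset ℕ => (γ u : ℝ) * prodKernel k u x x}

/-- The weighted kernel `K = ∑_u γ_u k_u` on `𝔛`. -/
def weightedKernel {D : Type*} (γ : Finset ℕ → ℝ≥0) (k : D → D → ℝ) (x y : domain γ k) : ℝ :=
  ∑' u : Finset ℕ, (γ u : ℝ) * prodKernel k u (x : ℕ → D) (y : ℕ → D)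

theorem summable_weightedKernel {D : Type*} (γ : Finset ℕ → ℝ≥0) (k : D → D → ℝ)
    [IsReproducingKernel k] (x y : domain γ k) :
    Summable fun u : Finset ℕ => (γ u : ℝ) * prodKernel k u (x : ℕ → D) (y : ℕ → D) := by
  refine Summable.of_norm_bounded (x.2.add y.2) fun u => ?_
  have := (prodKernel_isReproducingKernel k u).abs_le_diag (x : ℕ → D) y
  rw [Real.norm_eq_abs, abs_mul, abs_of_nonneg (γ u).coe_nonneg, ← mul_add]
  exact mul_le_mul_of_nonneg_left this (γ u).2

instance weightedKernel_isReproducingKernel {D : Type*} (γ : Finset ℕ → ℝ≥0) (k : D → D → ℝ)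
    [IsReproducingKernel k] : IsReproducingKernel (weightedKernel γ k) := by
  refine IsReproducingKernel.of (fun x y => ?_) fun c => ?_
  · exact tsum_congr fun u => by rw [(prodKernel_isReproducingKernel k u).symm]
  · have hs : ∀ x y : domain γ k, ∀ a b : ℝ, HasSum
        (fun u : Finset ℕ => a * ((γ u : ℝ) * prodKernel k u (x : ℕ → D) (y : ℕ → D)) * b)
        (a * weightedKernel γ k x y * b) := fun x y a b =>
      ((summable_weightedKernel γ k x y).hasSum.mul_left a).mul_right b
    have hsum : HasSum (fun u : Finset ℕ => c.sum fun x a => c.sum fun y b =>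
        a * ((γ u : ℝ) * prodKernel k u (x : ℕ → D) (y : ℕ → D)) * b)
        (c.sum fun x a => c.sum fun y b => a * weightedKernel γ k x y * b) :=
      hasSum_sum fun x _ => hasSum_sum fun y _ => hs x y _ _
    refine hsum.nonneg fun u => ?_
    have h := ((prodKernel_isReproducingKernel k u).posSemidef.submatrix
      (fun x : domain γ k => (x : ℕ → D))).2 c
    have h' := mul_nonneg (γ u).2 h
    refine h'.trans_eq ?_
    simp only [Finsupp.sum, Finset.mul_sum]
    refine Finset.sum_congr rfl fun x _ => Finset.sum_congr rfl fun y _ => ?_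
    simp
    ring

/-- Standing assumptions on the kernel `k` on `D × D`, the probability measure `ρ` on `D` and the
weights `γ`. -/
structure StandingAssumptions {D : Type*} [MeasurableSpace D] (ρ : Measure D) (k : D → D → ℝ)
    [IsReproducingKernel k] (γ : Finset ℕ → ℝ≥0) : Prop where
  kernel_ne_zero : k ≠ 0
  measurable_kernel : Measurable (Function.uncurry k)
  /-- `H(k) ∩ H(1) = {0}`, where `H(1)` is the space of constant functions. -/
  const_eq_zero : ∀ (f : RKSpace k) (c : ℝ), (∀ x, f x = c) → f = 0
  /-- `∫ k(x, y) ρ(dx) = 0` for all `y`. -/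
  integral_kernel : ∀ y, ∫ x, k x y ∂ρ = 0
  /-- `M = ∫ k(x, x) ρ(dx) < ∞`. -/
  integrable_diag : Integrable (fun x => k x x) ρ
  weight_empty : γ ∅ = 1
  /-- `∑_u γ_u M^|u| < ∞`. -/
  summable_weight : Summable fun u : Finset ℕ => (γ u : ℝ) * (∫ x, k x x ∂ρ) ^ u.card
  diag_pos : ∀ x, 0 < k x x

/-- A function on `𝔛`, extended by zero to `D^ℕ`. -/
def extendZero {D : Type*} {γ : Finset ℕ → ℝ≥0} {k : D → D → ℝ} (f : domain γ k → ℝ) :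
    (ℕ → D) → ℝ :=
  Function.extend Subtype.val f 0

/-- The integration functional `I(f) = ∫ f dμ`, with `μ = ⊗_{n ∈ ℕ} ρ`. -/
def integral {D : Type*} [MeasurableSpace D] (ρ : Measure D) {γ : Finset ℕ → ℝ≥0}
    {k : D → D → ℝ} (f : domain γ k → ℝ) : ℝ :=
  ∫ x, extendZero f x ∂(Measure.infinitePi fun _ : ℕ => ρ)

/-! ### Randomized linear quadrature rules -/

/-- A randomized linear quadrature rule with `n` deterministic coefficients and `n` random
points in `X`, the randomness being an element of `S`. -/
structure RandomRule (S X : Type*) (n : ℕ) where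
  weight : Fin n → ℝ
  point : Fin n → S → X

/-- `Q(ω, f) = ∑_i w_i f(x^{(i)}(ω))`. -/
def RandomRule.eval {S X : Type*} {n : ℕ} (Q : RandomRule S X n) (f : X → ℝ) (ω : S) : ℝ :=
  ∑ i, Q.weight i * f (Q.point i ω)

/-- Condition (*) for a family `V` of coordinate sets: for `v ∈ V` and `j ∈ v`, the `j`-th
component of each point depends on `ω_j` only, as a random variable with law `ρ`. -/
def RandomRule.IsCoordinatewise {Ω D ι : Type*} [MeasurableSpace Ω] [MeasurableSpace D] {n : ℕ}
    (Q : RandomRule (ι → Ω) (ι → D) n) (P : Measure Ω) (ρ : Measure D)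
    (V : Set (Finset ι)) : Prop :=
  ∀ v ∈ V, ∀ i, ∀ j ∈ v, ∃ ξ : Ω → D, Measurable ξ ∧ P.map ξ = ρ ∧ ∀ ω, Q.point i ω j = ξ (ω j)

/-- The assumptions on the `d`-dimensional rules `Q_n = Q_{[d],n}`, `n ≥ 1`: condition (*) for all
subsets of `[d]`, coefficients summing up to one, and
`Var(Q_n(f_u)) ≤ C_d n^{-α} ln(n)^β ‖f_u‖²` for all `u ⊆ [d]` and `f_u ∈ H_u`.
Since `ln 1 = 0`, the last condition is imposed for `n ≥ 2` only. -/
structure RuleAssumptions {Ω D : Type*} [MeasurableSpace Ω] [MeasurableSpace D]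
    (P : Measure Ω) (ρ : Measure D) (k : D → D → ℝ) [IsReproducingKernel k] (d : ℕ)
    (α β Cd : ℝ) (Q : ∀ n : ℕ, RandomRule (Fin d → Ω) (Fin d → D) n) : Prop where
  coordinatewise : ∀ n, 1 ≤ n → (Q n).IsCoordinatewise P ρ Set.univ
  sum_weight : ∀ n, 1 ≤ n → ∑ i, (Q n).weight i = 1
  variance_le : ∀ n, 2 ≤ n → ∀ (u : Finset (Fin d)) (f : RKSpace (prodKernel k u)),
    variance ((Q n).eval f) (Measure.pi fun _ : Fin d => P) ≤
      Cd * (n : ℝ) ^ (-α) * Real.log n ^ β * ‖f‖ ^ 2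

/-- `φ : ℕ → [d]` is injective on every active set. -/
def IsInjectiveOnActive (γ : Finset ℕ → ℝ≥0) {d : ℕ} (φ : ℕ → Fin d) : Prop :=
  ∀ u, 0 < γ u → Set.InjOn φ u

/-- `v = u₁ ∪ … ∪ u_L`. -/
def activeUnion (u : ℕ → Finset ℕ) (L : ℕ) : Finset ℕ :=
  (Finset.range L).biUnion u

/-- The algorithm `Q_{v,𝐚}`, `𝐚 = (a, a, …)`, obtained from a `d`-dimensional rule by replicating
its components along `φ`: it has the same coefficients and the points `(t_v; 𝐚)`, where
`t_ν = x_{φ(ν)}` for `ν ∈ v`. -/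
def RandomRule.replicate {S D : Type*} {d n : ℕ} (Q : RandomRule S (Fin d → D) n)
    (φ : ℕ → Fin d) (v : Finset ℕ) (a : D) : RandomRule S (ℕ → D) n where
  weight := Q.weight
  point i ω := fun ν => if ν ∈ v then Q.point i ω (φ ν) else a

/-! ### Cost and error -/

open scoped Classical in
/-- Cost of one function evaluation in the fixed subspace sampling model: `$(|v|)` at the points
of `𝔛_{v,𝐚} = {x | x_j = a for all j ∉ v}`, and `∞` elsewhere. -/
def fixedCost {D : Type*} (cost : ℕ → ℝ≥0) (v : Finset ℕ) (a : D) (x : ℕ → D) : ℝ≥0∞ :=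
  if ∀ j ∉ v, x j = a then (cost v.card : ℝ≥0∞) else ⊤

/-- The expected cost of a randomized rule: the sum of the costs `c` of all function evaluations.
It does not depend on the integrand. -/
def RandomRule.expectedCost {S X : Type*} [MeasurableSpace S] {n : ℕ} (Q : RandomRule S X n)
    (P : Measure S) (c : X → ℝ≥0∞) : ℝ≥0∞ :=
  ∫⁻ ω, ∑ i, c (Q.point i ω) ∂P

/-- The randomized error `e(Q, F) = (sup_{f ∈ F} 𝔼 (I(f) - Q(f))²)^{1/2}`. -/
def RandomRule.error {S D : Type*} [MeasurableSpace S] [MeasurableSpace D] {n : ℕ}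
    (Q : RandomRule S (ℕ → D) n) (P : Measure S) (ρ : Measure D) {γ : Finset ℕ → ℝ≥0}
    {k : D → D → ℝ} (F : Set (domain γ k → ℝ)) : ℝ≥0∞ :=
  (⨆ f ∈ F, ∫⁻ ω, ENNReal.ofReal ((integral ρ f - Q.eval (extendZero f) ω) ^ 2) ∂P) ^ (1 / 2 : ℝ)

end InfDimIntegration

end

open InfDimIntegration

/-! Every `f` in `H(K)` splits as `∑_w √γ_w g_w` with `g_w ∈ H(k_w)` and `∑_w ‖g_w‖² ≤ ‖f‖²`
(`exists_decomposition`). Since `k` has mean zero, only the term of `w = ∅` contributes to `I(f)`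
(`integral_eq_of_decomposition`), and the replicated rule reproduces that term because its
coefficients sum to one. The error is therefore the sum of `√γ_w Q(g_w)` over `w ≠ ∅`, split by
whether `w` meets `v = u₁ ∪ … ∪ u_L`.

If `w` misses `v`, the rule sees only the anchor and returns `g_w(𝐚)`
(`eval_replicate_of_disjoint`). Such an active `w` is none of `u₁, …, u_L`, so Cauchy–Schwarz bounds
the square of this part by the tail `∑_{j>L} γ̂_{u_j}`.

If `w` meets `v`, restricting `g_w` to the points `(t_v; 𝐚)` gives a `d`-variate function in
`H(k_{φ(w∩v)})`, by injectivity of `φ` on `w`, at the price of a factor `k(a,a)^{|w \ v|}` in the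
squared norm (`exists_replicated`). The variance bound for `Q_n` applies to it, and a weighted
Cauchy–Schwarz inequality sums these terms without any orthogonality between different `w`. Finite
order makes the weights `γ_w k(a,a)^{|w \ v|}` comparable with `γ̂_w`, hence summable uniformly in
`v`. The result is `sq_error_replicate_le`: squared error at most a constant times tail plus
variance bound.

The tail is `O(L^{-r})` for `1 + r < decay_γ`, and the cost is `O(n L^s)` because `|v| ≤ ωL`. Taking
`n ≈ L^{r/t'}` with `α - δ < t' < α` balances the two error terms (`exists_sampleSize`); the loss
`δ` pays for the logarithm and for `decay_γ` being only a supremum. `rate_of_bounds` then trades `L`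
for the cost. A suitable `φ` is a greedy coloring of the graph joining coordinates that share an
active set. -/

namespace InfDimIntegration

open scoped RealInnerProductSpace

/-! ### Sections of reproducing kernels and feature maps -/

section Kernel

variable {X : Type*} (K : X → X → ℝ) [hK : IsReproducingKernel K]

/-- The section `K(·, x)` as an element of `H(K)`. -/
noncomputable def kerSection (x : X) : RKSpace K := RKHS.kerFun (RKSpace K) x 1

variable {K} in
theorem inner_kerSection (f : RKSpace K) (x : X) : ⟪f, kerSection K x⟫ = f x := by
  simp [kerSection]

theorem kerSection_apply (x y : X) : kerSection K x y = K y x := by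
  have h := RKHS.kerFun_apply (RKSpace K) x (1 : ℝ) y
  rw [RKHS.OfKernel.kernel_ofKernel] at h
  simpa [kerSection, kernelMatrix] using h

theorem inner_kerSection_kerSection (x y : X) :
    ⟪kerSection K x, kerSection K y⟫ = K x y := by
  rw [inner_kerSection, kerSection_apply, hK.symm]

theorem topologicalClosure_span_kerSection :
    (Submodule.span ℝ (Set.range (kerSection K))).topologicalClosure = ⊤ := by
  rw [eq_top_iff, ← RKHS.kerFun_dense (RKSpace K)]
  refine Submodule.topologicalClosure_mono (Submodule.span_le.2 ?_)
  rintro _ ⟨x, c, rfl⟩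
  have : RKHS.kerFun (RKSpace K) x c = c • kerSection K x := by
    rw [kerSection, ← map_smul, smul_eq_mul, mul_one]
  rw [this]
  exact Submodule.smul_mem _ _ (Submodule.subset_span ⟨x, rfl⟩)

theorem denseRange_linearCombination_kerSection :
    DenseRange (Finsupp.linearCombination ℝ (kerSection K)) := by
  rw [DenseRange, ← LinearMap.coe_range, Finsupp.range_linearCombination]
  exact Submodule.dense_iff_topologicalClosure_eq_top.2 (topologicalClosure_span_kerSection K)

variable {K} in
theorem sq_apply_le (f : RKSpace K) (x : X) : f x ^ 2 ≤ ‖f‖ ^ 2 * K x x := by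
  rw [← inner_kerSection, ← inner_kerSection_kerSection K, real_inner_self_eq_norm_sq, ← mul_pow]
  exact sq_le_sq' (neg_le_of_abs_le (abs_real_inner_le_norm _ _)) (real_inner_le_norm _ _)

/-- Two continuous linear functionals on `H(K)` that agree on the sections of `K` are equal. -/
theorem functional_ext {S T : RKSpace K →L[ℝ] ℝ}
    (h : ∀ x, S (kerSection K x) = T (kerSection K x)) : S = T := by
  refine ContinuousLinearMap.ext_on (Submodule.dense_iff_topologicalClosure_eq_top.2
    (topologicalClosure_span_kerSection K)) ?_
  rintro _ ⟨x, rfl⟩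
  exact h x

variable {G : Type*} [NormedAddCommGroup G] [InnerProductSpace ℝ G] [CompleteSpace G]
  {K}

/-- A feature map `Φ` of the kernel `K` induces a contraction of `H(K)` into the feature space that
sends `K(·, x)` to `Φ x`. -/
theorem exists_featureMap (Φ : X → G) (hΦ : ∀ x y, ⟪Φ x, Φ y⟫ = K x y)
    : ∃ T : RKSpace K →L[ℝ] G, ‖T‖ ≤ 1 ∧ ∀ x, T (kerSection K x) = Φ x := by
  -- The inequality is an equality: both Gram matrices are `K`. It makes `∑ c_x K(·, x) ↦ ∑ c_x Φ x`
  -- well defined and bounded on a dense subspace, so it extends.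
  have key : ∀ c : X →₀ ℝ, ‖Finsupp.linearCombination ℝ Φ c‖
      ≤ 1 * ‖Finsupp.linearCombination ℝ (kerSection K) c‖ := fun c => by
    rw [one_mul, ← sq_le_sq₀ (norm_nonneg _) (norm_nonneg _), ← real_inner_self_eq_norm_sq,
      ← real_inner_self_eq_norm_sq]
    refine le_of_eq ?_
    simp only [Finsupp.linearCombination_apply, Finsupp.sum, sum_inner, inner_sum,
      real_inner_smul_left, real_inner_smul_right, hΦ, inner_kerSection_kerSection]
  have hd := denseRange_linearCombination_kerSection K
  refine ⟨(Finsupp.linearCombination ℝ Φ).extendOfNorm (Finsupp.linearCombination ℝ (kerSection K)),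
    LinearMap.opNorm_extendOfNorm_le hd zero_le_one key, fun x => ?_⟩
  have := LinearMap.extendOfNorm_eq (f := Finsupp.linearCombination ℝ Φ) hd ⟨1, key⟩
    (Finsupp.single x 1)
  simpa using this

/-- Every `f ∈ H(K)` is represented through a feature map of `K`. -/
theorem exists_feature (Φ : X → G) (hΦ : ∀ x y, ⟪Φ x, Φ y⟫ = K x y)
    (f : RKSpace K) : ∃ g : G, ‖g‖ ≤ ‖f‖ ∧ ∀ x, f x = ⟪g, Φ x⟫ := by
  obtain ⟨T, hT, hTx⟩ := exists_featureMap Φ hΦ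
  refine ⟨T f, (T.le_of_opNorm_le hT f).trans_eq (one_mul _), fun x => ?_⟩
  -- Evaluation at `x` and `f ↦ ⟪Φ x, T f⟫` are both continuous, so comparing them on sections
  -- suffices.
  have : (innerSL ℝ (kerSection K x)) = (innerSL ℝ (Φ x)).comp T := by
    refine functional_ext K fun y => ?_
    simp [hTx, hΦ, inner_kerSection_kerSection]
  have := DFunLike.congr_fun this f
  rw [← inner_kerSection, real_inner_comm, real_inner_comm (Φ x)]
  simpa using this

/-- Every element of the feature space represents an element of `H(K)`. -/
theorem exists_of_feature (Φ : X → G) (hΦ : ∀ x y, ⟪Φ x, Φ y⟫ = K x y)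
    (g : G) : ∃ f : RKSpace K, ‖f‖ ≤ ‖g‖ ∧ ∀ x, f x = ⟪g, Φ x⟫ := by
  obtain ⟨T, hT, hTx⟩ := exists_featureMap Φ hΦ
  refine ⟨T.adjoint g, ?_, fun x => ?_⟩
  · refine (T.adjoint.le_of_opNorm_le ?_ g).trans_eq (one_mul _)
    simpa using hT
  · rw [← inner_kerSection, ContinuousLinearMap.adjoint_inner_left, hTx]

end Kernel

/-- If `K(z x, z y) = c L(x, y)`, then `f ↦ f ∘ z` maps `H(K)` to `H(L)`, with squared norm at
most `c`. -/
theorem exists_comp {X Y : Type*} {K : X → X → ℝ} [IsReproducingKernel K] {L : Y → Y → ℝ}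
    [IsReproducingKernel L] (z : Y → X) {c : ℝ} (hc : 0 < c)
    (h : ∀ x y, K (z x) (z y) = c * L x y) (f : RKSpace K) :
    ∃ g : RKSpace L, ‖g‖ ^ 2 ≤ c * ‖f‖ ^ 2 ∧ ∀ y, g y = f (z y) := by
  have hs : 0 < √c := Real.sqrt_pos.2 hc
  -- The rescaled sections `c^{-1/2} K(·, z y)` form a feature map of `L` with values in `H(K)`;
  -- pairing them with `√c f` gives `f ∘ z`.
  obtain ⟨g, hg, hgf⟩ := exists_of_feature (K := L) (fun y => (√c)⁻¹ • kerSection K (z y))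
    (fun x y => by
      rw [real_inner_smul_left, real_inner_smul_right, inner_kerSection_kerSection, h,
        ← mul_assoc, ← mul_assoc, ← mul_inv, Real.mul_self_sqrt hc.le, inv_mul_cancel₀ hc.ne',
        one_mul]) (√c • f)
  refine ⟨g, ?_, fun y => ?_⟩
  · calc ‖g‖ ^ 2 ≤ ‖√c • f‖ ^ 2 := by gcongr
      _ = c * ‖f‖ ^ 2 := by
        rw [norm_smul, mul_pow, Real.norm_of_nonneg hs.le, Real.sq_sqrt hc.le]
  · rw [hgf, real_inner_smul_left, real_inner_smul_right, inner_kerSection, mul_inv_cancel_left₀ hs.ne']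

/-! ### Measurability -/

/-- The elements of `H(K)` are measurable if the sections of `K` are. -/
theorem measurable_coe {X : Type*} [MeasurableSpace X] {K : X → X → ℝ} [IsReproducingKernel K]
    (hK : ∀ y, Measurable fun x => K x y) (f : RKSpace K) : Measurable f := by
  have hd := denseRange_linearCombination_kerSection K
  obtain ⟨s, hs, hsf⟩ := mem_closure_iff_seq_limit.1 (hd f)
  -- Norm convergence in `H(K)` implies pointwise convergence, and finite combinations of sections
  -- are measurable.
  have hlim : ∀ x, Tendsto (fun n => s n x) atTop (𝓝 (f x)) := fun x =>
    ((RKHS.continuous_eval (H := RKSpace K) x).tendsto f).comp hsf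
  refine measurable_of_tendsto_metrizable (fun n => ?_) (tendsto_pi_nhds.2 hlim)
  obtain ⟨c, hc⟩ := hs n
  have : ⇑(s n) = fun x => ∑ y ∈ c.support, c y * K x y := by
    funext x
    rw [← hc, ← inner_kerSection]
    simp [Finsupp.linearCombination_apply, Finsupp.sum, sum_inner, real_inner_smul_left,
      inner_kerSection_kerSection, IsReproducingKernel.symm (K := K) inferInstance x]
  rw [this]
  exact Finset.measurable_sum _ fun y _ => (hK y).const_mul _

/-! ### Integration of functions from the spaces `H(k_u)` -/

/-- A function from `H(k_u)` depends on the variables from `u` only. -/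
theorem coe_congr {ι D : Type*} {k : D → D → ℝ} [IsReproducingKernel k] {u : Finset ι} (f : RKSpace (prodKernel k u)) {x y : ι → D}
    (h : ∀ j ∈ u, x j = y j) : f x = f y := by
  have : kerSection (prodKernel k u) x = kerSection (prodKernel k u) y := by
    refine RKHS.ext fun z => ?_
    rw [kerSection_apply, kerSection_apply]
    exact Finset.prod_congr rfl fun j hj => by rw [h j hj]
  rw [← inner_kerSection, this, inner_kerSection]

section Integration

variable {ι D : Type*} [MeasurableSpace D] {ρ : Measure D} [IsProbabilityMeasure ρ]

theorem integral_infinitePi_finset_prod {g : ι → D → ℝ} (hg : ∀ j, Measurable (g j))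
    (u : Finset ι) :
    ∫ x, ∏ j ∈ u, g j (x j) ∂(Measure.infinitePi fun _ : ι => ρ) = ∏ j ∈ u, ∫ t, g j t ∂ρ := by
  have h := integral_restrict_infinitePi (μ := fun _ : ι => ρ) (s := u)
    (f := fun y => ∏ j : u, g j (y j)) (by
      refine (Finset.measurable_prod _ fun j _ => ?_).aestronglyMeasurable
      exact (hg j).comp (measurable_pi_apply j))
  rw [← Finset.prod_coe_sort u, ← integral_fintype_prod_eq_prod, ← h]
  refine integral_congr_ae (ae_of_all _ fun x => ?_)
  exact (Finset.prod_coe_sort u fun j => g j (x j)).symm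

theorem integrable_infinitePi_finset_prod {g : D → ℝ} (hg : Integrable g ρ) (u : Finset ι) :
    Integrable (fun x : ι → D => ∏ j ∈ u, g (x j)) (Measure.infinitePi fun _ : ι => ρ) := by
  have h : Integrable (fun y : u → D => ∏ j, g (y j)) (Measure.pi fun _ => ρ) :=
    Integrable.fintype_prod fun _ => hg
  rw [← Measure.infinitePi_map_restrict (μ := fun _ : ι => ρ) (I := u)] at h
  have h' := h.comp_measurable (Finset.measurable_restrict u)
  refine h'.congr (ae_of_all _ fun x => ?_)
  exact Finset.prod_coe_sort u fun j => g (x j)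

variable {k : D → D → ℝ}

theorem integrable_prodKernel_diag (hi : Integrable (fun x => k x x) ρ) (u : Finset ι) :
    Integrable (fun x => prodKernel k u x x) (Measure.infinitePi fun _ : ι => ρ) :=
  integrable_infinitePi_finset_prod hi u

theorem integral_prodKernel_diag (hm : Measurable (Function.uncurry k)) (u : Finset ι) :
    ∫ x, prodKernel k u x x ∂(Measure.infinitePi fun _ : ι => ρ) = (∫ t, k t t ∂ρ) ^ u.card := by
  refine (integral_infinitePi_finset_prod (g := fun _ t => k t t)
    (fun _ => hm.comp (measurable_id.prodMk measurable_id)) u).trans ?_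
  rw [Finset.prod_const]

variable [IsReproducingKernel k]

theorem measurable_coe_prodKernel (hm : Measurable (Function.uncurry k)) {u : Finset ι}
    (f : RKSpace (prodKernel k u)) : Measurable f := by
  refine measurable_coe (K := prodKernel k u) (fun y => ?_) f
  exact Finset.measurable_prod _ fun j _ =>
    hm.comp (g := Function.uncurry k) (f := fun x : ι → D => (x j, y j))
      ((measurable_pi_apply j).prodMk measurable_const)

theorem memLp_two_coe (hm : Measurable (Function.uncurry k)) (hi : Integrable (fun x => k x x) ρ)
    {u : Finset ι} (f : RKSpace (prodKernel k u)) :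
    MemLp f 2 (Measure.infinitePi fun _ : ι => ρ) := by
  have hf := measurable_coe_prodKernel hm f
  rw [memLp_two_iff_integrable_sq hf.aestronglyMeasurable]
  refine ((integrable_prodKernel_diag hi u).const_mul (‖f‖ ^ 2)).mono'
    (hf.pow_const 2).aestronglyMeasurable (ae_of_all _ fun x => ?_)
  rw [Real.norm_of_nonneg (sq_nonneg _)]
  exact sq_apply_le f x

theorem integral_sq_le (hm : Measurable (Function.uncurry k)) (hi : Integrable (fun x => k x x) ρ)
    {u : Finset ι} (f : RKSpace (prodKernel k u)) :
    ∫ x, f x ^ 2 ∂(Measure.infinitePi fun _ : ι => ρ) ≤ ‖f‖ ^ 2 * (∫ t, k t t ∂ρ) ^ u.card := by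
  rw [← integral_prodKernel_diag hm, ← integral_const_mul]
  exact integral_mono (memLp_two_coe hm hi f).integrable_sq
    ((integrable_prodKernel_diag hi u).const_mul _) fun x => sq_apply_le f x

theorem sq_integral_le_integral_sq {Ω : Type*} [MeasurableSpace Ω] {P : Measure Ω}
    [IsProbabilityMeasure P] {X : Ω → ℝ} (hX : MemLp X 2 P) :
    (∫ ω, X ω ∂P) ^ 2 ≤ ∫ ω, X ω ^ 2 ∂P := by
  have h := variance_nonneg X P
  rw [variance_eq_sub hX] at h
  simpa using sub_nonneg.1 h

theorem integral_abs_coe_le (hm : Measurable (Function.uncurry k))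
    (hi : Integrable (fun x => k x x) ρ) {u : Finset ι} (f : RKSpace (prodKernel k u)) :
    ∫ x, |f x| ∂(Measure.infinitePi fun _ : ι => ρ) ≤ ‖f‖ * √((∫ t, k t t ∂ρ) ^ u.card) := by
  have h : (∫ x, |f x| ∂(Measure.infinitePi fun _ : ι => ρ)) ^ 2
      ≤ ∫ x, |f x| ^ 2 ∂(Measure.infinitePi fun _ : ι => ρ) :=
    sq_integral_le_integral_sq (memLp_two_coe hm hi f).abs
  simp only [sq_abs] at h
  refine (Real.le_sqrt_of_sq_le (h.trans (integral_sq_le hm hi f))).trans_eq ?_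
  rw [Real.sqrt_mul (sq_nonneg _), Real.sqrt_sq (norm_nonneg _)]

/-- If `∫ k(x, y) ρ(dx) = 0` for all `y`, then the functions from `H(k_u)`, `u ≠ ∅`, have
integral zero. -/
theorem integral_coe_eq_zero (hm : Measurable (Function.uncurry k))
    (hi : Integrable (fun x => k x x) ρ) (h0 : ∀ y, ∫ x, k x y ∂ρ = 0) {u : Finset ι}
    (hu : u.Nonempty) (f : RKSpace (prodKernel k u)) :
    ∫ x, f x ∂(Measure.infinitePi fun _ : ι => ρ) = 0 := by
  have hint : ∀ f : RKSpace (prodKernel k u), Integrable f (Measure.infinitePi fun _ : ι => ρ) :=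
    fun f => (memLp_two_coe hm hi f).integrable one_le_two
  let S : RKSpace (prodKernel k u) →ₗ[ℝ] ℝ :=
    { toFun := fun f => ∫ x, f x ∂(Measure.infinitePi fun _ : ι => ρ)
      map_add' := fun f g => by
        rw [← integral_add (hint f) (hint g)]
        simp
      map_smul' := fun c f => by
        rw [RingHom.id_apply, smul_eq_mul, ← integral_const_mul]
        simp }
  let T := S.mkContinuous √((∫ t, k t t ∂ρ) ^ u.card) fun f => by
    rw [mul_comm]
    exact (abs_integral_le_integral_abs).trans (integral_abs_coe_le hm hi f)
  -- Integration is continuous on `H(k_u)`, so sections suffice; there the integral factorizes, and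
  -- each factor with index in `u` is zero.
  have hT : T = 0 := by
    refine functional_ext _ fun y => ?_
    change ∫ x, kerSection (prodKernel k u) y x ∂(Measure.infinitePi fun _ : ι => ρ) = 0
    simp only [kerSection_apply, prodKernel]
    rw [integral_infinitePi_finset_prod (g := fun j t => k t (y j))
      (fun j => hm.comp (measurable_id.prodMk measurable_const))]
    obtain ⟨j, hj⟩ := hu
    exact Finset.prod_eq_zero hj (h0 _)
  exact DFunLike.congr_fun hT f

end Integration

/-! ### Coordinatewise random points -/

section Points

variable {Ω D : Type*} [MeasurableSpace Ω] [MeasurableSpace D] {P : Measure Ω}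
  {ρ : Measure D} [IsProbabilityMeasure ρ] {d n : ℕ}
  {Q : RandomRule (Fin d → Ω) (Fin d → D) n}

/-- The components use different coordinates of `ω`, hence are independent with law `ρ`. The target
is written as `Measure.infinitePi` so that the integration lemmas above serve both `Fin d` and `ℕ`.
-/
theorem RandomRule.IsCoordinatewise.measurePreserving (hQ : Q.IsCoordinatewise P ρ Set.univ)
    (i : Fin n) : MeasurePreserving (Q.point i) (Measure.pi fun _ => P)
      (Measure.infinitePi fun _ => ρ) := by
  choose ξ hξm hξ hQξ using fun j => hQ Finset.univ (Set.mem_univ _) i j (Finset.mem_univ j)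
  have hp : Q.point i = fun ω j => ξ j (ω j) := funext fun ω => funext fun j => hQξ j ω
  have hpm : Measurable (Q.point i) := by
    rw [hp]
    exact measurable_pi_lambda _ fun j => (hξm j).comp (measurable_pi_apply j)
  refine ⟨hpm, ?_⟩
  have : ∀ j, SigmaFinite (P.map (ξ j)) := fun j => by rw [hξ]; infer_instance
  rw [hp, Measure.infinitePi_eq_pi, Measure.pi_map_pi fun j => (hξm j).aemeasurable]
  simp only [hξ]

variable {k : D → D → ℝ} [IsReproducingKernel k]

theorem RandomRule.IsCoordinatewise.memLp_eval (hQ : Q.IsCoordinatewise P ρ Set.univ)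
    (hm : Measurable (Function.uncurry k)) (hi : Integrable (fun x => k x x) ρ)
    {u : Finset (Fin d)} (f : RKSpace (prodKernel k u)) :
    MemLp (Q.eval f) 2 (Measure.pi fun _ => P) :=
  memLp_finsetSum _ fun i _ =>
    ((memLp_two_coe hm hi f).comp_measurePreserving (hQ.measurePreserving i)).const_mul _

variable [IsProbabilityMeasure P]

theorem RandomRule.IsCoordinatewise.integral_eval (hQ : Q.IsCoordinatewise P ρ Set.univ)
    (hm : Measurable (Function.uncurry k)) (hi : Integrable (fun x => k x x) ρ)
    (h0 : ∀ y, ∫ x, k x y ∂ρ = 0) {u : Finset (Fin d)} (hu : u.Nonempty)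
    (f : RKSpace (prodKernel k u)) :
    ∫ ω, Q.eval f ω ∂(Measure.pi fun _ => P) = 0 := by
  have hint : ∀ i, Integrable (fun ω => f (Q.point i ω)) (Measure.pi fun _ => P) := fun i =>
    ((memLp_two_coe hm hi f).comp_measurePreserving (hQ.measurePreserving i)).integrable
      one_le_two
  unfold RandomRule.eval
  rw [integral_finsetSum _ fun i _ => (hint i).const_mul _]
  refine Finset.sum_eq_zero fun i _ => ?_
  have hp := hQ.measurePreserving i
  rw [integral_const_mul, ← integral_map (f := f) hp.measurable.aemeasurable
    (measurable_coe_prodKernel hm f).aestronglyMeasurable, hp.map_eq,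
    integral_coe_eq_zero hm hi h0 hu, mul_zero]

/-- The second moment of `Q_n(f_u)`, `u ≠ ∅`, is bounded by the variance bound. -/
theorem RuleAssumptions.lintegral_sq_eval_le {α β Cd : ℝ}
    {Q : ∀ n : ℕ, RandomRule (Fin d → Ω) (Fin d → D) n} (hQ : RuleAssumptions P ρ k d α β Cd Q)
    (hm : Measurable (Function.uncurry k)) (hi : Integrable (fun x => k x x) ρ)
    (h0 : ∀ y, ∫ x, k x y ∂ρ = 0) (hn : 2 ≤ n) {u : Finset (Fin d)} (hu : u.Nonempty)
    (f : RKSpace (prodKernel k u)) :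
    ∫⁻ ω, ENNReal.ofReal ((Q n).eval f ω ^ 2) ∂(Measure.pi fun _ => P) ≤
      ENNReal.ofReal (Cd * (n : ℝ) ^ (-α) * Real.log n ^ β * ‖f‖ ^ 2) := by
  have hc := hQ.coordinatewise n (one_le_two.trans hn)
  have hL := hc.memLp_eval hm hi f
  rw [← ofReal_integral_eq_lintegral_ofReal hL.integrable_sq (ae_of_all _ fun _ => sq_nonneg _),
    ← variance_of_integral_eq_zero hL.aemeasurable (hc.integral_eval hm hi h0 hu f)]
  exact ENNReal.ofReal_le_ofReal (hQ.variance_le n hn u f)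

end Points

/-! ### The decomposition of functions from `H(K)` -/

section Decomposition

variable {D : Type*} {γ : Finset ℕ → ℝ≥0} {k : D → D → ℝ} [IsReproducingKernel k]

/-- The squared norms are `γ_w k_w(x, x)`, so square summability is exactly membership in `𝔛`. -/
theorem memlp_feature (x : domain γ k) :
    Memℓp (fun w : Finset ℕ => √(γ w : ℝ) • kerSection (prodKernel k w) (x : ℕ → D)) 2 := by
  refine memℓp_gen ?_
  have h := x.2
  refine Summable.congr h fun w => ?_
  rw [ENNReal.toReal_ofNat, Real.rpow_ofNat, norm_smul, mul_pow, Real.norm_of_nonneg (Real.sqrt_nonneg _),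
    Real.sq_sqrt (γ w).coe_nonneg, ← real_inner_self_eq_norm_sq, inner_kerSection_kerSection]

/-- Every `f ∈ H(K)` is a sum `f = ∑_w √γ_w g_w` with `g_w ∈ H(k_w)` and `∑_w ‖g_w‖² ≤ ‖f‖²`. -/
theorem exists_decomposition (f : RKSpace (weightedKernel γ k)) :
    ∃ g : ∀ w : Finset ℕ, RKSpace (prodKernel (ι := ℕ) k w),
      (Summable fun w => ‖g w‖ ^ 2) ∧ ∑' w, ‖g w‖ ^ 2 ≤ ‖f‖ ^ 2 ∧
      ∀ x : domain γ k, HasSum (fun w => √(γ w : ℝ) * g w (x : ℕ → D)) (f x) := by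
  obtain ⟨g, hg, hfg⟩ := exists_feature (K := weightedKernel γ k)
    (G := lp (fun w : Finset ℕ => RKSpace (prodKernel (ι := ℕ) k w)) 2)
    (fun x => ⟨_, memlp_feature x⟩) (fun x y => by
      rw [lp.inner_eq_tsum]
      refine tsum_congr fun w => ?_
      change ⟪√(γ w : ℝ) • kerSection (prodKernel k w) (x : ℕ → D),
        √(γ w : ℝ) • kerSection (prodKernel k w) (y : ℕ → D)⟫ = _
      rw [real_inner_smul_left, real_inner_smul_right, inner_kerSection_kerSection, ← mul_assoc,
        Real.mul_self_sqrt (γ w).coe_nonneg]) f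
  have hsq : HasSum (fun w => ‖g w‖ ^ 2) (‖g‖ ^ 2) := by
    have := lp.hasSum_norm (p := 2) (by norm_num) g
    simpa using this
  refine ⟨fun w => g w, hsq.summable, ?_, fun x => ?_⟩
  · rw [hsq.tsum_eq]
    gcongr
  · rw [hfg]
    have h : (fun w => √(γ w : ℝ) * g w (x : ℕ → D)) =
        fun w => ⟪g w, √(γ w : ℝ) • kerSection (prodKernel k w) (x : ℕ → D)⟫ :=
      funext fun w => by rw [real_inner_smul_right, inner_kerSection]
    rw [h]
    exact lp.hasSum_inner g ⟨_, memlp_feature x⟩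

/-- Points that differ from the anchor in finitely many components belong to `𝔛`. -/
theorem anchored_mem_domain {a : D} (hk : 0 < k a a)
    (ha : Summable fun w : Finset ℕ => (γ w : ℝ) * k a a ^ w.card) (v : Finset ℕ) (t : ℕ → D) :
    (fun ν => if ν ∈ v then t ν else a) ∈ domain γ k := by
  set x : ℕ → D := fun ν => if ν ∈ v then t ν else a
  have hK : ∀ y, 0 ≤ k y y := IsReproducingKernel.diag_nonneg inferInstance
  -- `b ν` compares the diagonal of `k` at `x ν` with its value at the anchor. It is at least `1`,
  -- and equals `1` off `v`, so its product over any `w` is at most its product over `v`.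
  let b : ℕ → ℝ := fun ν => max 1 (k (x ν) (x ν) / k a a)
  have hb1 : ∀ ν, 1 ≤ b ν := fun ν => le_max_left _ _
  have hb : ∀ ν, k (x ν) (x ν) ≤ b ν * k a a := fun ν => by
    rw [← div_le_iff₀ hk]
    exact le_max_right _ _
  have hbv : ∀ ν ∉ v, b ν = 1 := fun ν hν => by
    simp [b, x, hν, div_self hk.ne']
  refine Summable.of_nonneg_of_le (fun w => mul_nonneg (γ w).2
    (Finset.prod_nonneg fun j _ => hK _)) (fun w => ?_) (ha.mul_left (∏ ν ∈ v, b ν))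
  have h1 : ∏ j ∈ w, b j ≤ ∏ ν ∈ v, b ν := by
    rw [← Finset.prod_subset (Finset.inter_subset_left (s₁ := w) (s₂ := v)) fun ν hw hν =>
      hbv ν fun h => hν (Finset.mem_inter.2 ⟨hw, h⟩)]
    exact Finset.prod_le_prod_of_subset_of_one_le Finset.inter_subset_right
      (fun ν _ => zero_le_one.trans (hb1 ν)) fun ν _ _ => hb1 ν
  have h2 : prodKernel k w x x ≤ (∏ ν ∈ v, b ν) * k a a ^ w.card := by
    calc prodKernel k w x x ≤ ∏ j ∈ w, b j * k a a :=
          Finset.prod_le_prod (fun j _ => hK _) fun j _ => hb j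
      _ = (∏ j ∈ w, b j) * k a a ^ w.card := by rw [Finset.prod_mul_distrib, Finset.prod_const]
      _ ≤ _ := by gcongr
  calc (γ w : ℝ) * prodKernel k w x x ≤ γ w * ((∏ ν ∈ v, b ν) * k a a ^ w.card) := by gcongr
    _ = _ := by ring

variable [MeasurableSpace D] {ρ : Measure D} [IsProbabilityMeasure ρ]

/-- By Tonelli, `∑_w γ_w k_w(x, x)` has the finite integral `∑_w γ_w M^{|w|}`. -/
theorem ae_mem_domain (hA : StandingAssumptions ρ k γ) :
    ∀ᵐ x ∂(Measure.infinitePi fun _ : ℕ => ρ), x ∈ domain γ k := by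
  have hnn : ∀ (w : Finset ℕ) (x : ℕ → D), 0 ≤ (γ w : ℝ) * prodKernel k w x x := fun w x =>
    mul_nonneg (γ w).2 ((prodKernel_isReproducingKernel k w).diag_nonneg x)
  have hint : ∀ w : Finset ℕ, Integrable (fun x : ℕ → D => (γ w : ℝ) * prodKernel k w x x)
      (Measure.infinitePi fun _ : ℕ => ρ) := fun w =>
    (integrable_prodKernel_diag hA.integrable_diag w).const_mul _
  have h : ∫⁻ x, ∑' w : Finset ℕ, ENNReal.ofReal ((γ w : ℝ) * prodKernel k w x x)
      ∂(Measure.infinitePi fun _ : ℕ => ρ) ≠ ⊤ := by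
    rw [lintegral_tsum fun w => (hint w).aemeasurable.ennreal_ofReal]
    simp_rw [← fun w => ofReal_integral_eq_lintegral_ofReal (hint w) (ae_of_all _ (hnn w)),
      integral_const_mul, integral_prodKernel_diag hA.measurable_kernel]
    exact hA.summable_weight.tsum_ofReal_ne_top
  have hmeas : AEMeasurable (fun x : ℕ → D => ∑' w : Finset ℕ,
      ENNReal.ofReal ((γ w : ℝ) * prodKernel k w x x)) (Measure.infinitePi fun _ : ℕ => ρ) :=
    AEMeasurable.tsum fun w => (hint w).aemeasurable.ennreal_ofReal
  filter_upwards [ae_lt_top' hmeas h] with x hx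
  refine (ENNReal.summable_toReal hx.ne).congr fun w => ?_
  rw [ENNReal.toReal_ofReal (hnn w x)]

theorem integral_eq_of_decomposition (hA : StandingAssumptions ρ k γ) (f : domain γ k → ℝ)
    {g : ∀ w : Finset ℕ, RKSpace (prodKernel (ι := ℕ) k w)} (hg : Summable fun w => ‖g w‖ ^ 2)
    (hf : ∀ x : domain γ k, HasSum (fun w => √(γ w : ℝ) * g w (x : ℕ → D)) (f x)) (y : ℕ → D) :
    integral ρ f = √(γ ∅ : ℝ) * g ∅ y := by
  have hm := hA.measurable_kernel
  have hi := hA.integrable_diag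
  have hM : 0 ≤ ∫ t, k t t ∂ρ := integral_nonneg fun t =>
    IsReproducingKernel.diag_nonneg inferInstance t
  have hint : ∀ w, Integrable (fun x => √(γ w : ℝ) * g w x) (Measure.infinitePi fun _ : ℕ => ρ) :=
    fun w => ((memLp_two_coe hm hi (g w)).integrable one_le_two).const_mul _
  have hsum : Summable fun w => ∫ x, ‖√(γ w : ℝ) * g w x‖ ∂(Measure.infinitePi fun _ : ℕ => ρ) := by
    refine Summable.of_nonneg_of_le (fun w => integral_nonneg fun x => norm_nonneg _) (fun w => ?_)
      -- The integral of the `w`-term is at most `‖g_w‖ √(γ_w M^{|w|})`, hence by `2pq ≤ p² + q²` at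
      -- most `‖g_w‖² + γ_w M^{|w|}`.
      (hg.add hA.summable_weight)
    simp_rw [norm_mul, integral_const_mul, Real.norm_of_nonneg (Real.sqrt_nonneg _)]
    have h1 : ∫ x, ‖g w x‖ ∂(Measure.infinitePi fun _ : ℕ => ρ) ≤ _ :=
      integral_abs_coe_le hm hi (g w)
    have h2 := two_mul_le_add_sq ‖g w‖ (√(γ w : ℝ) * √((∫ t, k t t ∂ρ) ^ w.card))
    rw [mul_pow, Real.sq_sqrt (γ w).coe_nonneg, Real.sq_sqrt (pow_nonneg hM _)] at h2
    have h3 := mul_le_mul_of_nonneg_left h1 (Real.sqrt_nonneg (γ w : ℝ))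
    have h4 : 0 ≤ ‖g w‖ * (√(γ w : ℝ) * √((∫ t, k t t ∂ρ) ^ w.card)) := by positivity
    nlinarith
  have hI := hasSum_integral_of_summable_integral_norm hint hsum
  have h0 : ∀ w ≠ ∅, ∫ x, √(γ w : ℝ) * g w x ∂(Measure.infinitePi fun _ : ℕ => ρ) = 0 :=
    fun w hw => by
      rw [integral_const_mul, integral_coe_eq_zero hm hi hA.integral_kernel
        (Finset.nonempty_iff_ne_empty.2 hw), mul_zero]
  have h1 : ∫ x, √(γ ∅ : ℝ) * g ∅ x ∂(Measure.infinitePi fun _ : ℕ => ρ) = √(γ ∅ : ℝ) * g ∅ y := by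
    simp_rw [fun x => coe_congr (g ∅) (x := x) (y := y) (by simp)]
    simp
  rw [← h1, ← hI.unique (hasSum_single ∅ h0)]
  refine integral_congr_ae ?_
  filter_upwards [ae_mem_domain hA] with x hx
  have : extendZero f x = f ⟨x, hx⟩ := Subtype.val_injective.extend_apply f 0 ⟨x, hx⟩
  rw [this, ← (hf ⟨x, hx⟩).tsum_eq]

end Decomposition

/-! ### The error of the replicated rules -/

theorem sq_le_tsum_mul_tsum {ι : Type*} {T p q : ι → ℝ} {B : ℝ} (hT : HasSum T B)
    (hp : ∀ i, 0 ≤ p i) (hq : ∀ i, 0 ≤ q i) (hps : Summable p) (hqs : Summable q)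
    (h : ∀ i, T i ^ 2 ≤ p i * q i) : B ^ 2 ≤ (∑' i, p i) * ∑' i, q i := by
  refine le_of_tendsto (hT.pow 2) (Eventually.of_forall fun s => ?_)
  refine (Finset.sum_sq_le_sum_mul_sum_of_sq_le_mul s (fun i _ => hp i) (fun i _ => hq i)
    fun i _ => h i).trans ?_
  exact mul_le_mul (hps.sum_le_tsum s fun i _ => hp i) (hqs.sum_le_tsum s fun i _ => hq i)
    (Finset.sum_nonneg fun i _ => hq i) (tsum_nonneg hp)

/-! ### Truncation of the weights: sets disjoint from `v` and sets meeting `v` -/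

section Weights

variable {D : Type*} {γ : Finset ℕ → ℝ≥0} {k : D → D → ℝ} {a : D} {u : ℕ → Finset ℕ}

theorem hatWeight_eq (w : Finset ℕ) : hatWeight γ k a w = γ w * k a a ^ w.card := by
  simp [hatWeight, prodKernel]

theorem hatWeight_nonneg (hk : 0 < k a a) (w : Finset ℕ) : 0 ≤ hatWeight γ k a w := by
  rw [hatWeight_eq]
  positivity

theorem IsWeightOrdering.summable (hu : IsWeightOrdering γ k a u)
    (ha : Summable fun w : Finset ℕ => (γ w : ℝ) * k a a ^ w.card) :
    Summable fun j => hatWeight γ k a (u j) := by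
  simp_rw [hatWeight_eq]
  exact ha.comp_injective hu.injective

open scoped Classical in
-- A nonempty set disjoint from `v` cannot be one of the sets whose union is `v`, so the first `L`
-- terms along the ordering drop out.
theorem tsum_hatWeight_disjoint_le (hk : 0 < k a a) (hu : IsWeightOrdering γ k a u)
    (ha : Summable fun w : Finset ℕ => (γ w : ℝ) * k a a ^ w.card) (L : ℕ) :
    (∑' w : Finset ℕ, if w.Nonempty ∧ Disjoint w (activeUnion u L) then hatWeight γ k a w else 0) ≤
      ∑' j, hatWeight γ k a (u (j + L)) := by
  set τ : Finset ℕ → ℝ := fun w =>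
    if w.Nonempty ∧ Disjoint w (activeUnion u L) then hatWeight γ k a w else 0
  have hτ0 : ∀ w, 0 ≤ τ w := fun w => by
    simp only [τ]
    split_ifs
    exacts [hatWeight_nonneg hk w, le_rfl]
  have hτ : ∀ w, τ w ≤ hatWeight γ k a w := fun w => by
    simp only [τ]
    split_ifs
    exacts [le_rfl, hatWeight_nonneg hk w]
  have hsupp : Function.support τ ⊆ Set.range u := by
    intro w hw
    rw [hu.range_eq]
    by_contra hcon
    refine hw ?_
    simp only [τ, hatWeight_eq]
    split_ifs with h
    · have : γ w = 0 := by
        by_contra h'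
        exact hcon ⟨h.1, pos_iff_ne_zero.2 h'⟩
      simp [this]
    · rfl
  have hs := hu.summable ha
  have hsτ : Summable fun j => τ (u j) :=
    Summable.of_nonneg_of_le (fun j => hτ0 _) (fun j => hτ _) hs
  rw [← hu.injective.tsum_eq hsupp, ← hsτ.sum_add_tsum_nat_add L, Finset.sum_eq_zero, zero_add]
  · exact ((summable_nat_add_iff L).2 hsτ).tsum_le_tsum (fun j => hτ _)
      ((summable_nat_add_iff L).2 hs)
  · intro j hj
    have hsub : u j ⊆ activeUnion u L := Finset.subset_biUnion_of_mem u hj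
    have : ¬ ((u j).Nonempty ∧ Disjoint (u j) (activeUnion u L)) := fun h =>
      h.1.ne_empty (Finset.disjoint_self_iff_empty _ |>.1 (h.2.mono_right hsub))
    simp [τ, this]

/-- Finiteness turns the random part of the error into a finite sum, so expectations can be taken
termwise. -/
theorem HasCoordinateBound.finite_setOf_meets {η : ℕ} (hη : HasCoordinateBound γ η)
    (v : Finset ℕ) : {w | 0 < γ w ∧ ¬ Disjoint w v}.Finite := by
  have : {w | 0 < γ w ∧ ¬ Disjoint w v} ⊆ ⋃ j ∈ v, {w | 0 < γ w ∧ j ∈ w} := by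
    rintro w ⟨hw, hwv⟩
    obtain ⟨j, hj, hjv⟩ := Finset.not_disjoint_iff.1 hwv
    exact Set.mem_biUnion hjv ⟨hw, hj⟩
  exact (v.finite_toSet.biUnion fun j _ => Set.finite_of_encard_le_coe (hη j)).subset this

/-- The factor `b^o` that compares the weights `γ_w k(a,a)^{|w \ v|}` with `γ̂_w`. -/
theorem weight_sdiff_le (hk : 0 < k a a) {o : ℕ} (ho : HasFiniteOrder γ o) (v w : Finset ℕ) :
    (γ w : ℝ) * k a a ^ (w \ v).card ≤
      max 1 (k a a)⁻¹ ^ o * ((γ w : ℝ) * k a a ^ w.card) := by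
  rcases lt_or_ge o w.card with h | h
  · simp [ho w h]
  have hb : 1 ≤ max 1 (k a a)⁻¹ := le_max_left _ _
  have hb' : 1 ≤ max 1 (k a a)⁻¹ * k a a := by
    rw [← div_le_iff₀ hk, one_div]
    exact le_max_right _ _
  have hc := Finset.card_sdiff_add_card_inter w v
  have h1 : k a a ^ (w \ v).card ≤ max 1 (k a a)⁻¹ ^ o * k a a ^ w.card := by
    calc k a a ^ (w \ v).card
        ≤ k a a ^ (w \ v).card * (max 1 (k a a)⁻¹ * k a a) ^ (w ∩ v).card :=
          le_mul_of_one_le_right (by positivity) (one_le_pow₀ hb')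
      _ = max 1 (k a a)⁻¹ ^ (w ∩ v).card * k a a ^ w.card := by
          rw [mul_pow, ← hc, pow_add]; ring
      _ ≤ _ := by
          gcongr ?_ * _
          exact pow_le_pow_right₀ hb ((Finset.card_le_card Finset.inter_subset_left).trans h)
  calc (γ w : ℝ) * k a a ^ (w \ v).card ≤ γ w * (max 1 (k a a)⁻¹ ^ o * k a a ^ w.card) := by gcongr
    _ = _ := by ring

end Weights

/-! ### Replication and the error bound -/

section Error

variable {D : Type*} {γ : Finset ℕ → ℝ≥0} {k : D → D → ℝ} [IsReproducingKernel k]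

/-- The restriction of a function from `H(k_w)` to the points `(t_v; 𝐚)`, `t_ν = y_{φ(ν)}`, as a
function of `y`. -/
theorem exists_replicated {d : ℕ} {a : D} (hk : 0 < k a a) (v w : Finset ℕ) {φ : ℕ → Fin d}
    (hφ : Set.InjOn φ w) (f : RKSpace (prodKernel (ι := ℕ) k w)) :
    ∃ g : RKSpace (prodKernel k ((w ∩ v).image φ)),
      ‖g‖ ^ 2 ≤ k a a ^ (w \ v).card * ‖f‖ ^ 2 ∧
      ∀ y, g y = f fun ν => if ν ∈ v then y (φ ν) else a := by
  refine exists_comp (fun (y : Fin d → D) ν => if ν ∈ v then y (φ ν) else a)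
    (pow_pos hk _) (fun x y => ?_) f
  have h1 : ∏ j ∈ w \ v, k (if j ∈ v then x (φ j) else a) (if j ∈ v then y (φ j) else a)
      = k a a ^ (w \ v).card := by
    rw [← Finset.prod_const]
    refine Finset.prod_congr rfl fun j hj => ?_
    simp [(Finset.mem_sdiff.1 hj).2]
  have h2 : ∏ j ∈ w ∩ v, k (if j ∈ v then x (φ j) else a) (if j ∈ v then y (φ j) else a)
      = prodKernel k ((w ∩ v).image φ) x y := by
    rw [prodKernel, Finset.prod_image fun i hi j hj h =>
      hφ (Finset.mem_inter.1 hi).1 (Finset.mem_inter.1 hj).1 h]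
    refine Finset.prod_congr rfl fun j hj => ?_
    simp [(Finset.mem_inter.1 hj).2]
  rw [prodKernel, ← Finset.prod_inter_mul_prod_sdiff w v, h1, h2, mul_comm]

end Error

section Error

variable {D : Type*} {γ : Finset ℕ → ℝ≥0} {k : D → D → ℝ} [IsReproducingKernel k]
  {a : D} {u : ℕ → Finset ℕ} {d n : ℕ}

/-- All points `(t_v; 𝐚)` lie in `𝔛`, so the extension by zero is never felt and the decomposition
holds at each of them. -/
theorem hasSum_eval_replicate {S : Type*} (hk : 0 < k a a)
    (ha : Summable fun w : Finset ℕ => (γ w : ℝ) * k a a ^ w.card)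
    (Q : RandomRule S (Fin d → D) n) (φ : ℕ → Fin d) (v : Finset ℕ) {f : domain γ k → ℝ}
    {g : ∀ w : Finset ℕ, RKSpace (prodKernel (ι := ℕ) k w)}
    (hf : ∀ x : domain γ k, HasSum (fun w => √(γ w : ℝ) * g w (x : ℕ → D)) (f x)) (ω : S) :
    HasSum (fun w => √(γ w : ℝ) * (Q.replicate φ v a).eval (g w) ω)
      ((Q.replicate φ v a).eval (extendZero f) ω) := by
  have hx : ∀ i, (Q.replicate φ v a).point i ω ∈ domain γ k := fun i =>
    anchored_mem_domain hk ha v fun ν => Q.point i ω (φ ν)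
  have hfx : ∀ i, extendZero f ((Q.replicate φ v a).point i ω) = f ⟨_, hx i⟩ := fun i =>
    Subtype.val_injective.extend_apply f 0 ⟨_, hx i⟩
  simp only [RandomRule.eval, hfx, Finset.mul_sum, mul_left_comm (√_)]
  exact hasSum_sum fun i _ => (hf ⟨_, hx i⟩).mul_left _

/-- If `w` does not meet `v`, then the replicated rule evaluates `g ∈ H(k_w)` at the anchor. -/
theorem eval_replicate_of_disjoint {S : Type*} {Q : RandomRule S (Fin d → D) n}
    (hw1 : ∑ i, Q.weight i = 1) (φ : ℕ → Fin d) {v w : Finset ℕ} (hwv : Disjoint w v)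
    (g : RKSpace (prodKernel (ι := ℕ) k w)) (ω : S) :
    (Q.replicate φ v a).eval g ω = g fun _ => a := by
  have : ∀ i, g ((Q.replicate φ v a).point i ω) = g fun _ => a := fun i =>
    coe_congr g fun j hj => by
      simp [RandomRule.replicate, Finset.disjoint_left.1 hwv hj]
  simp only [RandomRule.eval, this, ← Finset.sum_mul]
  exact (congrArg (· * _) hw1).trans (one_mul _)

/-- A bound for each fixed `ω`: two applications of Cauchy–Schwarz, one to the deterministic
truncation error `B` and one to the terms of sets meeting `v`. -/
theorem sq_error_le {S : Type*} (hk : 0 < k a a) (hu : IsWeightOrdering γ k a u)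
    (ha : Summable fun w : Finset ℕ => (γ w : ℝ) * k a a ^ w.card) {o : ℕ}
    (ho : HasFiniteOrder γ o) {Q : RandomRule S (Fin d → D) n}
    (hw1 : ∑ i, Q.weight i = 1) (φ : ℕ → Fin d) {L : ℕ} {f : domain γ k → ℝ}
    {g : ∀ w : Finset ℕ, RKSpace (prodKernel (ι := ℕ) k w)}
    (hg : Summable fun w => ‖g w‖ ^ 2) (hg1 : ∑' w, ‖g w‖ ^ 2 ≤ 1)
    (hf : ∀ x : domain γ k, HasSum (fun w => √(γ w : ℝ) * g w (x : ℕ → D)) (f x))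
    {A : Finset (Finset ℕ)} (hA : ∀ w, w ∈ A ↔ 0 < γ w ∧ ¬ Disjoint w (activeUnion u L)) (ω : S) :
    (√(γ ∅ : ℝ) * g ∅ (fun _ => a) - (Q.replicate φ (activeUnion u L) a).eval (extendZero f) ω) ^ 2
      ≤ 2 * (∑' j, hatWeight γ k a (u (j + L))) +
        2 * (max 1 (k a a)⁻¹ ^ o * ∑' w : Finset ℕ, (γ w : ℝ) * k a a ^ w.card) *
          ∑ w ∈ A, (k a a ^ (w \ activeUnion u L).card)⁻¹ *
            (Q.replicate φ (activeUnion u L) a).eval (g w) ω ^ 2 := by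
  classical
  set v := activeUnion u L
  set E : ℝ := (Q.replicate φ v a).eval (extendZero f) ω
  set T : Finset ℕ → ℝ := fun w => √(γ w : ℝ) * (Q.replicate φ v a).eval (g w) ω
  have hT : HasSum T E := hasSum_eval_replicate hk ha Q φ v hf ω
  have hdis : ∀ w, Disjoint w v → T w = √(γ w : ℝ) * g w fun _ => a := fun w hw => by
    simp only [T, eval_replicate_of_disjoint hw1 φ hw]
  have hempty : ∅ ∉ A := fun h => ((hA ∅).1 h).2 (Finset.disjoint_empty_left v)
  -- the part of the series that belongs to the sets disjoint from `v`
  set A' : Finset (Finset ℕ) := insert ∅ A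
  have hT' : HasSum (fun w => if w ∈ A' then 0 else T w) (E - ∑ w ∈ A', T w) := by
    have h1 : HasSum (fun w => if w ∈ A' then T w else 0)
        (∑ w ∈ A', if w ∈ A' then T w else 0) :=
      hasSum_sum_of_ne_finset_zero fun w hw => if_neg hw
    rw [Finset.sum_congr rfl fun w hw => if_pos hw] at h1
    have h2 : (fun w => if w ∈ A' then 0 else T w) =
        fun w => T w - if w ∈ A' then T w else 0 := by
      funext w
      split_ifs <;> simp
    rw [h2]
    exact hT.sub h1
  rw [Finset.sum_insert hempty, hdis ∅ (Finset.disjoint_empty_left v)] at hT'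
  set B : ℝ := E - (√(γ ∅ : ℝ) * g ∅ (fun _ => a) + ∑ w ∈ A, T w)
  have hhat := hatWeight_nonneg (γ := γ) hk
  have htail : 0 ≤ ∑' j, hatWeight γ k a (u (j + L)) := tsum_nonneg fun j => hhat _
  have hB : B ^ 2 ≤ ∑' j, hatWeight γ k a (u (j + L)) := by
    have hq0 : ∀ w : Finset ℕ,
        0 ≤ if w.Nonempty ∧ Disjoint w v then hatWeight γ k a w else 0 := fun w => by
      split_ifs
      exacts [hhat w, le_rfl]
    refine (sq_le_tsum_mul_tsum hT' (p := fun w => ‖g w‖ ^ 2)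
      (q := fun w => if w.Nonempty ∧ Disjoint w v then hatWeight γ k a w else 0)
      (fun w => sq_nonneg _) hq0 hg
      (Summable.of_nonneg_of_le hq0 (fun w => ?_) ha) fun w => ?_).trans ?_
    · rw [← hatWeight_eq]
      split_ifs
      exacts [le_rfl, hhat w]
    · by_cases hwA : w ∈ A'
      · rw [if_pos hwA, zero_pow two_ne_zero]
        exact mul_nonneg (sq_nonneg _) (hq0 w)
      rw [if_neg hwA]
      by_cases hγ : γ w = 0
      · simp only [T, hγ, NNReal.coe_zero, Real.sqrt_zero, zero_mul, zero_pow two_ne_zero]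
        exact mul_nonneg (sq_nonneg _) (hq0 w)
      have hne : w.Nonempty := Finset.nonempty_iff_ne_empty.2 fun h =>
        hwA (h ▸ Finset.mem_insert_self _ _)
      have hdw : Disjoint w v := by
        by_contra h
        exact hwA (Finset.mem_insert_of_mem ((hA w).2 ⟨pos_iff_ne_zero.2 hγ, h⟩))
      rw [if_pos ⟨hne, hdw⟩, hdis w hdw, mul_pow, Real.sq_sqrt (γ w).coe_nonneg, hatWeight,
        mul_left_comm]
      exact mul_le_mul_of_nonneg_left (sq_apply_le (g w) _) (γ w).2
    · exact (mul_le_of_le_one_left (tsum_nonneg hq0) hg1).trans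
        (tsum_hatWeight_disjoint_le hk hu ha L)
  have hc : ∀ w : Finset ℕ, 0 < k a a ^ (w \ v).card := fun w => pow_pos hk _
  -- The split by `k(a,a)^{|w \ v|}` is chosen so that the inverse factor cancels the norm factor of
  -- `exists_replicated` once expectations are taken.
  have hY : (∑ w ∈ A, T w) ^ 2 ≤
      (max 1 (k a a)⁻¹ ^ o * ∑' w : Finset ℕ, (γ w : ℝ) * k a a ^ w.card) *
        ∑ w ∈ A, (k a a ^ (w \ v).card)⁻¹ * (Q.replicate φ v a).eval (g w) ω ^ 2 := by
    refine (Finset.sum_sq_le_sum_mul_sum_of_sq_le_mul A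
      (f := fun w => (γ w : ℝ) * k a a ^ (w \ v).card)
      (g := fun w => (k a a ^ (w \ v).card)⁻¹ * (Q.replicate φ v a).eval (g w) ω ^ 2)
      (fun w _ => by positivity) (fun w _ => by positivity) fun w _ => ?_).trans ?_
    · simp only [T]
      rw [mul_pow, Real.sq_sqrt (γ w).coe_nonneg, mul_assoc, mul_inv_cancel_left₀ (hc w).ne']
    · refine mul_le_mul_of_nonneg_right ?_ (Finset.sum_nonneg fun w _ => by positivity)
      calc ∑ w ∈ A, (γ w : ℝ) * k a a ^ (w \ v).card
          ≤ ∑ w ∈ A, max 1 (k a a)⁻¹ ^ o * ((γ w : ℝ) * k a a ^ w.card) :=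
            Finset.sum_le_sum fun w _ => weight_sdiff_le hk ho v w
        _ ≤ _ := by
            rw [← Finset.mul_sum]
            exact mul_le_mul_of_nonneg_left
              (ha.sum_le_tsum A fun w _ => by positivity) (by positivity)
  have hEB : √(γ ∅ : ℝ) * g ∅ (fun _ => a) - E = -(B + ∑ w ∈ A, T w) := by
    simp only [B]
    ring
  rw [hEB, neg_sq]
  have := add_sq_le (a := B) (b := ∑ w ∈ A, T w)
  linarith

variable [MeasurableSpace D] {ρ : Measure D} [IsProbabilityMeasure ρ]
  {Ω : Type*} [MeasurableSpace Ω] {P : Measure Ω} [IsProbabilityMeasure P]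

theorem sq_error_replicate_le (hA : StandingAssumptions ρ k γ) (hu : IsWeightOrdering γ k a u)
    (ha : Summable fun w : Finset ℕ => (γ w : ℝ) * k a a ^ w.card) {o η : ℕ}
    (ho : HasFiniteOrder γ o) (hη : HasCoordinateBound γ η) {α β Cd : ℝ}
    {Q : ∀ n : ℕ, RandomRule (Fin d → Ω) (Fin d → D) n} (hQ : RuleAssumptions P ρ k d α β Cd Q)
    (hn : 2 ≤ n) {φ : ℕ → Fin d} (hφ : IsInjectiveOnActive γ φ) (L : ℕ) :
    ((Q n).replicate φ (activeUnion u L) a).error (Measure.pi fun _ => P) ρ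
        (unitBall (weightedKernel γ k)) ^ 2 ≤
      ENNReal.ofReal (2 * (∑' j, hatWeight γ k a (u (j + L))) +
        2 * (max 1 (k a a)⁻¹ ^ o * ∑' w : Finset ℕ, (γ w : ℝ) * k a a ^ w.card) *
          (|Cd| * (n : ℝ) ^ (-α) * Real.log n ^ β)) := by
  have hk := hA.diag_pos a
  have hm := hA.measurable_kernel
  have hi := hA.integrable_diag
  set v := activeUnion u L
  set R := (Q n).replicate φ v a
  set tail := ∑' j, hatWeight γ k a (u (j + L))
  set S := max 1 (k a a)⁻¹ ^ o * ∑' w : Finset ℕ, (γ w : ℝ) * k a a ^ w.card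
  set V := |Cd| * (n : ℝ) ^ (-α) * Real.log n ^ β
  have hlog : 0 ≤ Real.log n := Real.log_natCast_nonneg n
  have hV : 0 ≤ V := by positivity
  have htail : 0 ≤ tail := tsum_nonneg fun j => hatWeight_nonneg hk _
  have hS : 0 ≤ S := mul_nonneg (by positivity) (tsum_nonneg fun w => by positivity)
  rw [RandomRule.error, ← ENNReal.rpow_natCast, ← ENNReal.rpow_mul]
  norm_num only [ENNReal.rpow_one]
  refine iSup₂_le ?_
  rintro _ ⟨f, hf1, rfl⟩
  obtain ⟨g, hg, hgf, hfg⟩ := exists_decomposition f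
  have hg1 : ∑' w, ‖g w‖ ^ 2 ≤ 1 := hgf.trans (pow_le_one₀ (norm_nonneg _) hf1)
  rw [integral_eq_of_decomposition hA f hg hfg fun _ => a]
  set A := (hη.finite_setOf_meets v).toFinset
  have hAm : ∀ w, w ∈ A ↔ 0 < γ w ∧ ¬ Disjoint w v := fun w => by simp [A]
  have hsecond : ∀ w ∈ A, AEMeasurable (fun ω => R.eval (g w) ω) (Measure.pi fun _ => P) ∧
      ∫⁻ ω, ENNReal.ofReal (R.eval (g w) ω ^ 2) ∂(Measure.pi fun _ => P) ≤
        ENNReal.ofReal (V * (k a a ^ (w \ v).card * ‖g w‖ ^ 2)) := by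
    intro w hw
    obtain ⟨hγw, hwv⟩ := (hAm w).1 hw
    obtain ⟨h, hh, hhg⟩ := exists_replicated hk v w (hφ w hγw) (g w)
    have hR : R.eval (g w) = (Q n).eval h := by
      funext ω
      simp only [RandomRule.eval, hhg]
      rfl
    -- Nonemptiness gives `(Q n).eval h` mean zero, so its second moment is its variance.
    have hne : ((w ∩ v).image φ).Nonempty :=
      (Finset.not_disjoint_iff_nonempty_inter.1 hwv).image φ
    rw [hR]
    refine ⟨((hQ.coordinatewise n (one_le_two.trans hn)).memLp_eval hm hi h).aemeasurable,
      (hQ.lintegral_sq_eval_le hm hi hA.integral_kernel hn hne h).trans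
        (ENNReal.ofReal_le_ofReal ?_)⟩
    refine mul_le_mul ?_ hh (sq_nonneg _) hV
    simp only [V]
    gcongr
    exact le_abs_self _
  calc _ ≤ ∫⁻ ω, (ENNReal.ofReal (2 * tail) + ENNReal.ofReal (2 * S) *
        ∑ w ∈ A, ENNReal.ofReal (k a a ^ (w \ v).card)⁻¹ * ENNReal.ofReal (R.eval (g w) ω ^ 2))
          ∂(Measure.pi fun _ => P) := by
        refine lintegral_mono fun ω => ?_
        refine (ENNReal.ofReal_le_ofReal (sq_error_le hk hu ha ho
          (hQ.sum_weight n (one_le_two.trans hn)) φ hg hg1 hfg hAm ω)).trans_eq ?_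
        change ENNReal.ofReal (2 * tail + 2 * S *
          ∑ w ∈ A, (k a a ^ (w \ v).card)⁻¹ * R.eval (g w) ω ^ 2) = _
        rw [ENNReal.ofReal_add (by positivity) (mul_nonneg (by positivity)
          (Finset.sum_nonneg fun w _ => by positivity)),
          ENNReal.ofReal_mul (p := 2 * S) (by positivity),
          ENNReal.ofReal_sum_of_nonneg fun w _ => by positivity]
        congr 2
        exact Finset.sum_congr rfl fun w _ => ENNReal.ofReal_mul (by positivity)
    _ = ENNReal.ofReal (2 * tail) + ENNReal.ofReal (2 * S) *
        ∑ w ∈ A, ENNReal.ofReal (k a a ^ (w \ v).card)⁻¹ *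
          ∫⁻ ω, ENNReal.ofReal (R.eval (g w) ω ^ 2) ∂(Measure.pi fun _ => P) := by
        have hme : ∀ w ∈ A, AEMeasurable (fun ω => ENNReal.ofReal (R.eval (g w) ω ^ 2))
            (Measure.pi fun _ => P) := fun w hw => ((hsecond w hw).1.pow_const 2).ennreal_ofReal
        rw [lintegral_add_left measurable_const, lintegral_const, measure_univ, mul_one,
          lintegral_const_mul' _ _ ENNReal.ofReal_ne_top,
          lintegral_finsetSum' _ fun w hw => (hme w hw).const_mul _]
        simp_rw [lintegral_const_mul' _ _ ENNReal.ofReal_ne_top]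
    _ ≤ ENNReal.ofReal (2 * tail) + ENNReal.ofReal (2 * S) *
        ∑ w ∈ A, ENNReal.ofReal (V * ‖g w‖ ^ 2) := by
        gcongr with w hw
        refine (mul_le_mul_right (hsecond w hw).2 _).trans_eq ?_
        rw [← ENNReal.ofReal_mul (by positivity)]
        congr 1
        have := (pow_pos hk (w \ v).card).ne'
        field_simp
    _ ≤ ENNReal.ofReal (2 * tail) + ENNReal.ofReal (2 * S) * ENNReal.ofReal V := by
        rw [← ENNReal.ofReal_sum_of_nonneg fun w _ => by positivity, ← Finset.mul_sum]
        gcongr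
        exact mul_le_of_le_one_right hV ((hg.sum_le_tsum A fun w _ => sq_nonneg _).trans hg1)
    _ = _ := by
        rw [ENNReal.ofReal_add (by positivity) (by positivity),
          ENNReal.ofReal_mul (p := 2 * S) (by positivity)]

end Error

/-! ### Colorings -/

/-- A greedy coloring with `m + 1` colors: the color of `j` differs from the colors of the
`i ∈ N j`, `i < j`, if there is such a color. -/
noncomputable def greedyColor (N : ℕ → Finset ℕ) (m j : ℕ) : Fin (m + 1) :=
  Classical.epsilon fun c => ∀ i (_ : i < j), i ∈ N j → greedyColor N m i ≠ c
termination_by j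

theorem greedyColor_ne {N : ℕ → Finset ℕ} {m : ℕ} (hN : ∀ j, (N j).card ≤ m) {i j : ℕ}
    (hij : i < j) (hi : i ∈ N j) : greedyColor N m i ≠ greedyColor N m j := by
  classical
  have hex : ∃ c : Fin (m + 1), ∀ i (_ : i < j), i ∈ N j → greedyColor N m i ≠ c := by
    have hcard : ((N j).image (greedyColor N m)).card < (Finset.univ : Finset (Fin (m + 1))).card := by
      rw [Finset.card_univ, Fintype.card_fin]
      exact Nat.lt_succ_of_le (Finset.card_image_le.trans (hN j))
    obtain ⟨c, -, hc⟩ := Finset.exists_mem_notMem_of_card_lt_card hcard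
    exact ⟨c, fun i _ hi h => hc (Finset.mem_image.2 ⟨i, hi, h⟩)⟩
  rw [greedyColor.eq_1 N m j]
  exact Classical.epsilon_spec hex i hij hi

/-- A coordinate lies in at most `η` active sets, each containing at most `o - 1` others. It thus
has at most `η (o - 1)` neighbours, and one more color suffices for the greedy coloring. -/
theorem exists_isInjectiveOnActive {γ : Finset ℕ → ℝ≥0} {o η : ℕ} (ho : HasFiniteOrder γ o)
    (hη : HasCoordinateBound γ η) :
    ∃ φ : ℕ → Fin (η * (o - 1) + 1), IsInjectiveOnActive γ φ := by
  classical
  have hfin : ∀ j, {w | 0 < γ w ∧ j ∈ w}.Finite := fun j => Set.finite_of_encard_le_coe (hη j)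
  let N : ℕ → Finset ℕ := fun j => (hfin j).toFinset.biUnion fun w => w.erase j
  have hN : ∀ j, (N j).card ≤ η * (o - 1) := fun j => by
    refine (Finset.card_biUnion_le_card_mul _ _ (o - 1) fun w hw => ?_).trans
      (Nat.mul_le_mul_right _ ?_)
    · obtain ⟨hw, hj⟩ := (hfin j).mem_toFinset.1 hw
      rw [Finset.card_erase_of_mem hj]
      refine Nat.sub_le_sub_right (not_lt.1 fun h => hw.ne' (ho w h)) 1
    · have := hη j
      rw [(hfin j).encard_eq_coe_toFinset_card] at this
      exact_mod_cast this
  have key : ∀ w, 0 < γ w → ∀ i ∈ w, ∀ j ∈ w, i < j →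
      greedyColor N (η * (o - 1)) i ≠ greedyColor N (η * (o - 1)) j := fun w hw i hi j hj hij =>
    greedyColor_ne hN hij (Finset.mem_biUnion.2
      ⟨w, (hfin j).mem_toFinset.2 ⟨hw, hj⟩, Finset.mem_erase.2 ⟨hij.ne, hi⟩⟩)
  refine ⟨greedyColor N (η * (o - 1)), fun w hw i hi j hj hij => ?_⟩
  rcases lt_trichotomy i j with h | h | h
  · exact absurd hij (key w hw i hi j hj h)
  · exact h
  · exact absurd hij.symm (key w hw j hj i hi h)

/-! ### Cost -/

theorem expectedCost_replicate {S D : Type*} [MeasurableSpace S] (P : Measure S)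
    [IsProbabilityMeasure P] {d n : ℕ} (Q : RandomRule S (Fin d → D) n) (φ : ℕ → Fin d)
    (v : Finset ℕ) (a : D) (cost : ℕ → ℝ≥0) :
    (Q.replicate φ v a).expectedCost P (fixedCost cost v a) = n * (cost v.card : ℝ≥0∞) := by
  have : ∀ i ω, fixedCost cost v a ((Q.replicate φ v a).point i ω) = cost v.card := fun i ω =>
    if_pos fun j hj => by simp [RandomRule.replicate, hj]
  simp [RandomRule.expectedCost, this]

theorem exists_cost_le {cost : ℕ → ℝ≥0} (hcost : Monotone cost) {s : ℝ} (hs : 0 < s)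
    (h : (fun ν : ℕ => (cost ν : ℝ)) =O[atTop] fun ν : ℕ => (ν : ℝ) ^ s) :
    ∃ c > 0, ∀ ν, (cost ν : ℝ) ≤ c * ((ν : ℝ) + 1) ^ s := by
  obtain ⟨c, hc, hcb⟩ := h.exists_pos
  obtain ⟨m, hm⟩ := eventually_atTop.1 hcb.bound
  -- The asymptotic bound is used at `ν + m ≥ m`, and `ν + m ≤ (m + 1)(ν + 1)`; monotonicity of the
  -- cost brings it back to `ν`, including `ν = 0`.
  refine ⟨c * ((m : ℝ) + 1) ^ s, by positivity, fun ν => ?_⟩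
  have h1 : (cost (ν + m) : ℝ) ≤ c * ((ν + m : ℕ) : ℝ) ^ s := by
    have := hm (ν + m) (Nat.le_add_left m ν)
    rwa [Real.norm_of_nonneg (cost _).coe_nonneg, Real.norm_of_nonneg (by positivity)] at this
  calc (cost ν : ℝ) ≤ cost (ν + m) := NNReal.coe_le_coe.2 (hcost (Nat.le_add_right ν m))
    _ ≤ c * ((ν + m : ℕ) : ℝ) ^ s := h1
    _ ≤ c * (((m : ℝ) + 1) * ((ν : ℝ) + 1)) ^ s := by
        gcongr
        push_cast
        nlinarith [(Nat.cast_nonneg m : (0 : ℝ) ≤ m), (Nat.cast_nonneg ν : (0 : ℝ) ≤ ν)]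
    _ = _ := by rw [Real.mul_rpow (by positivity) (by positivity), mul_assoc]

theorem card_activeUnion_le {D : Type*} {γ : Finset ℕ → ℝ≥0} {k : D → D → ℝ} {a : D}
    {u : ℕ → Finset ℕ} (hu : IsWeightOrdering γ k a u) {o : ℕ} (ho : HasFiniteOrder γ o) (L : ℕ) :
    (activeUnion u L).card ≤ L * o := by
  refine (Finset.card_biUnion_le_card_mul _ _ o fun j _ => ?_).trans_eq (by simp)
  have : u j ∈ {v | v.Nonempty ∧ 0 < γ v} := hu.range_eq ▸ Set.mem_range_self j
  exact not_lt.1 fun h => this.2.ne' (ho _ h)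

/-! ### Asymptotics -/

theorem exists_rpow_mul_log_rpow_le {α t β : ℝ} (h : t < α) :
    ∃ c > 0, ∀ n : ℕ, 2 ≤ n → (n : ℝ) ^ (-α) * Real.log n ^ β ≤ c * (n : ℝ) ^ (-t) := by
  suffices ∃ c > 0, ∀ n : ℕ, 2 ≤ n → Real.log n ^ β ≤ c * (n : ℝ) ^ (α - t) by
    obtain ⟨c, hc, H⟩ := this
    refine ⟨c, hc, fun n hn => ?_⟩
    have hn0 : (0 : ℝ) < n := by positivity
    calc (n : ℝ) ^ (-α) * Real.log n ^ β ≤ (n : ℝ) ^ (-α) * (c * (n : ℝ) ^ (α - t)) := by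
          gcongr
          exact H n hn
      _ = c * (n : ℝ) ^ (-t) := by
          rw [mul_left_comm, ← Real.rpow_add hn0]
          congr 2
          ring
  -- For `β ≤ 0` the extremal case is `n = 2`, where the logarithm is still positive; for `β > 0`
  -- the logarithm is dominated by a small power.
  rcases le_or_gt β 0 with hβ | hβ
  · refine ⟨Real.log 2 ^ β, Real.rpow_pos_of_pos (Real.log_pos one_lt_two) _, fun n hn => ?_⟩
    have hn' : (2 : ℝ) ≤ n := by exact_mod_cast hn
    calc Real.log n ^ β ≤ Real.log 2 ^ β :=
          Real.rpow_le_rpow_of_nonpos (Real.log_pos one_lt_two)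
            (Real.log_le_log two_pos hn') hβ
      _ ≤ _ := le_mul_of_one_le_right (Real.rpow_nonneg (Real.log_pos one_lt_two).le _)
          (Real.one_le_rpow (by linarith) (by linarith))
  · have hε : 0 < (α - t) / β := div_pos (by linarith) hβ
    refine ⟨(((α - t) / β) ^ β)⁻¹, by positivity, fun n hn => ?_⟩
    calc Real.log n ^ β ≤ ((n : ℝ) ^ ((α - t) / β) / ((α - t) / β)) ^ β := by
          gcongr
          exact Real.log_le_rpow_div (Nat.cast_nonneg n) hε
      _ = _ := by
          rw [Real.div_rpow (by positivity) hε.le, ← Real.rpow_mul (by positivity),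
            div_mul_cancel₀ _ hβ.ne', div_eq_inv_mul]

/-! ### Decay of the ordered weights and of their tails -/

section Decay

variable {D : Type*} {γ : Finset ℕ → ℝ≥0} {k : D → D → ℝ} {a : D} {u : ℕ → Finset ℕ}

/-- The weights are decreasing and summable, so `j` times the `j`-th weight is at most the total
sum; every `p < 1` is then admissible in the supremum. -/
theorem one_le_decay (hk : 0 < k a a) (hu : IsWeightOrdering γ k a u)
    (ha : Summable fun w : Finset ℕ => (γ w : ℝ) * k a a ^ w.card) : 1 ≤ decay γ k a u := by
  have hs := hu.summable ha
  have hnn := hatWeight_nonneg (γ := γ) hk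
  have hb : ∀ j : ℕ, hatWeight γ k a (u j) * ((j : ℝ) + 1) ≤ ∑' j, hatWeight γ k a (u j) := by
    intro j
    refine le_trans ?_ (hs.sum_le_tsum (Finset.range (j + 1)) fun i _ => hnn _)
    calc hatWeight γ k a (u j) * ((j : ℝ) + 1)
        = ∑ _i ∈ Finset.range (j + 1), hatWeight γ k a (u j) := by simp [mul_comm]
      _ ≤ _ := Finset.sum_le_sum fun i hi =>
          hu.antitone (Nat.lt_succ_iff.1 (Finset.mem_range.1 hi))
  have hp : ∀ p : ℝ, p < 1 → (p : EReal) ≤ decay γ k a u := fun p hp => by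
    refine le_sSup ⟨p, ?_, rfl⟩
    have hlim : Tendsto (fun j : ℕ => (∑' j, hatWeight γ k a (u j)) *
        ((j : ℝ) + 1) ^ (-(1 - p))) atTop (𝓝 0) := by
      rw [← mul_zero (∑' j, hatWeight γ k a (u j))]
      refine Tendsto.const_mul _ ((tendsto_rpow_neg_atTop (by linarith)).comp ?_)
      exact tendsto_atTop_add_const_right _ _ tendsto_natCast_atTop_atTop
    refine squeeze_zero (fun j => mul_nonneg (hnn _) (by positivity)) (fun j => ?_) hlim
    have hj : (0 : ℝ) < (j : ℝ) + 1 := by positivity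
    calc hatWeight γ k a (u j) * ((j : ℝ) + 1) ^ p
        = hatWeight γ k a (u j) * ((j : ℝ) + 1) * ((j : ℝ) + 1) ^ (-(1 - p)) := by
          have h := Real.rpow_add hj 1 (-(1 - p))
          rw [Real.rpow_one] at h
          rw [mul_assoc, ← h]
          congr 2
          ring
      _ ≤ _ := by
          gcongr
          exact hb j
  refine le_of_forall_lt fun c hc => ?_
  obtain ⟨p, hcp, hp1⟩ := EReal.lt_iff_exists_real_btwn.1 hc
  exact hcp.trans_le (hp p (by exact_mod_cast hp1))

theorem exists_tail_le (hk : 0 < k a a) {r : ℝ} (hr : 0 ≤ r)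
    (h : ((1 + r : ℝ) : EReal) < decay γ k a u) :
    ∃ c ≥ 0, ∀ L : ℕ, 1 ≤ L → ∑' j, hatWeight γ k a (u (j + L)) ≤ c * (L : ℝ) ^ (-r) := by
  -- With an admissible `p > 1 + r`, the bound `(j + 1)^{-p}` splits into `(j + 1)^{-r}`, which
  -- yields `L^{-r}` on the tail, and `(j + 1)^{-(p - r)}`, which is summable.
  obtain ⟨_, ⟨p, hp, rfl⟩, hrp⟩ := lt_sSup_iff.1 h
  have hrp : 1 + r < p := EReal.coe_lt_coe_iff.1 hrp
  obtain ⟨b, hb⟩ := hp.bddAbove_range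
  have hb' : ∀ j : ℕ, hatWeight γ k a (u j) * ((j : ℝ) + 1) ^ p ≤ b := fun j => hb ⟨j, rfl⟩
  have hb0 : 0 ≤ b := (mul_nonneg (hatWeight_nonneg hk _) (by positivity)).trans (hb' 0)
  have hsum : Summable fun j : ℕ => ((j : ℝ) + 1) ^ (-(p - r)) := by
    have := (summable_nat_add_iff 1).2 (Real.summable_nat_rpow.2 (show -(p - r) < -1 by linarith))
    simpa using this
  have hle : ∀ L : ℕ, 1 ≤ L → ∀ j : ℕ, hatWeight γ k a (u (j + L)) ≤
      b * (L : ℝ) ^ (-r) * ((j : ℝ) + 1) ^ (-(p - r)) := by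
    intro L hL j
    have hL' : (0 : ℝ) < L := by exact_mod_cast hL
    have hx : (0 : ℝ) < ((j + L : ℕ) : ℝ) + 1 := by positivity
    calc hatWeight γ k a (u (j + L))
        = hatWeight γ k a (u (j + L)) * (((j + L : ℕ) : ℝ) + 1) ^ p *
            (((j + L : ℕ) : ℝ) + 1) ^ (-p) := by
          rw [mul_assoc, ← Real.rpow_add hx]
          simp
      _ ≤ b * (((j + L : ℕ) : ℝ) + 1) ^ (-p) := by
          gcongr
          exact hb' _
      _ = b * (((j + L : ℕ) : ℝ) + 1) ^ (-r) * (((j + L : ℕ) : ℝ) + 1) ^ (-(p - r)) := by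
          rw [mul_assoc, ← Real.rpow_add hx]
          congr 2
          ring
      _ ≤ _ := by
          have h1 : (((j + L : ℕ) : ℝ) + 1) ^ (-r) ≤ (L : ℝ) ^ (-r) :=
            Real.rpow_le_rpow_of_nonpos hL' (by push_cast; linarith [(Nat.cast_nonneg j : (0:ℝ) ≤ j)])
              (by linarith)
          have h2 : (((j + L : ℕ) : ℝ) + 1) ^ (-(p - r)) ≤ ((j : ℝ) + 1) ^ (-(p - r)) :=
            Real.rpow_le_rpow_of_nonpos (by positivity) (by push_cast; linarith) (by linarith)
          gcongr
  refine ⟨b * ∑' j : ℕ, ((j : ℝ) + 1) ^ (-(p - r)),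
    mul_nonneg hb0 (tsum_nonneg fun j => by positivity), fun L hL => ?_⟩
  have hs2 := hsum.mul_left (b * (L : ℝ) ^ (-r))
  refine ((Summable.of_nonneg_of_le (fun j => hatWeight_nonneg hk _) (hle L hL) hs2).tsum_le_tsum
    (hle L hL) hs2).trans_eq ?_
  rw [tsum_mul_left]
  ring

end Decay

/-- For `q > 1`, the rate `t (q - 1) / (t s + q - 1)` is dominated by the corresponding rate for
larger `t` and some exponent `1 + r < q`. -/
theorem exists_rateExponent_le {t t' s : ℝ} (ht : 0 < t) (htt : t < t') (hs : 0 < s) {q : EReal}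
    (hq : 1 < q) :
    ∃ r > 0, ((1 + r : ℝ) : EReal) < q ∧ rateExponent t s q ≤ t' * r / (t' * s + r) := by
  have ht' : 0 < t' := ht.trans htt
  have hd : 0 < t' - t := sub_pos.2 htt
  by_cases htop : q = ⊤
  · have hr : 0 < t * t' * s / (t' - t) := by positivity
    refine ⟨_, hr, htop ▸ EReal.coe_lt_top _, ?_⟩
    rw [rateExponent, if_pos htop, le_div_iff₀ (by positivity)]
    have : (t' - t) * (t * t' * s / (t' - t)) = t * t' * s := by field_simp
    linarith
  · lift q to ℝ using ⟨htop, (lt_trans (by exact EReal.bot_lt_coe 1) hq).ne'⟩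
    have hq1 : 1 < q := by exact_mod_cast hq
    obtain ⟨Q, rfl⟩ : ∃ Q, q = 1 + Q := ⟨q - 1, by ring⟩
    have hQ : 0 < Q := by linarith
    have hden : 0 < t * t' * s + (t' - t) * Q := by positivity
    -- This `r` makes the two rates equal, and `t < t'` forces `r < Q`.
    have hr : 0 < t * t' * s * Q / (t * t' * s + (t' - t) * Q) := by positivity
    refine ⟨_, hr, ?_, ?_⟩
    · rw [EReal.coe_lt_coe_iff, add_lt_add_iff_left, div_lt_iff₀ hden]
      have : 0 < (t' - t) * Q * Q := by positivity
      nlinarith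
    · rw [rateExponent, if_neg htop, EReal.toReal_coe, add_sub_cancel_left,
        show t * s + (1 + Q) - 1 = t * s + Q by ring,
        div_le_div_iff₀ (by positivity) (by positivity)]
      have : t * t' * s * Q / (t * t' * s + (t' - t) * Q) * (t * t' * s + (t' - t) * Q)
          = t * t' * s * Q := div_mul_cancel₀ _ hden.ne'
      linarith

theorem rateExponent_nonneg {t s : ℝ} (ht : 0 ≤ t) (hs : 0 ≤ s) {q : EReal} (hq : 1 ≤ q) :
    0 ≤ rateExponent t s q := by
  rw [rateExponent]
  split_ifs with h
  · exact ht
  · lift q to ℝ using ⟨h, ((EReal.bot_lt_coe 1).trans_le hq).ne'⟩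
    have hq1 : 1 ≤ q := by exact_mod_cast hq
    rw [EReal.toReal_coe]
    have := mul_nonneg ht hs
    exact div_nonneg (mul_nonneg ht (by linarith)) (by linarith)

/-- Sample sizes that balance the truncation error, the variance bound and the cost. -/
theorem exists_sampleSize {D : Type*} {γ : Finset ℕ → ℝ≥0} {k : D → D → ℝ} {a : D}
    {u : ℕ → Finset ℕ} (hk : 0 < k a a) (hu : IsWeightOrdering γ k a u)
    (ha : Summable fun w : Finset ℕ => (γ w : ℝ) * k a a ^ w.card) {α β δ s c : ℝ} (hδ : 0 < δ)
    (hδα : δ < α) (hs : 0 < s) (hc : 0 ≤ c) :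
    ∃ e > 0, ∃ b ≥ 0, ∃ n : ℕ → ℕ, (∀ L, 2 ≤ n L) ∧ ∀ L : ℕ, 1 ≤ L →
      2 * (∑' j, hatWeight γ k a (u (j + L))) +
          c * ((n L : ℝ) ^ (-α) * Real.log (n L) ^ β) ≤
        b * (L : ℝ) ^ (-(e * rateExponent (α - δ) s (decay γ k a u))) ∧
      (n L : ℝ) * (L : ℝ) ^ s ≤ 2 * (L : ℝ) ^ e := by
  have hnn := hatWeight_nonneg (γ := γ) hk
  rcases (one_le_decay hk hu ha).lt_or_eq with hq | hq
  · obtain ⟨r, hr, hrq, hx⟩ := exists_rateExponent_le (t := α - δ) (t' := α - δ / 2) (s := s)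
      (by linarith) (by linarith) hs hq
    set t' := α - δ / 2
    have ht' : 0 < t' := by simp only [t']; linarith
    obtain ⟨c₁, hc₁, htail⟩ := exists_tail_le hk hr.le hrq
    obtain ⟨c₂, hc₂, hlog⟩ := exists_rpow_mul_log_rpow_le (α := α) (t := t') (β := β)
      (by simp only [t']; linarith)
    -- `n ≈ L^{r/t'}` makes `n^{-t'}` at most `L^{-r}`, the order of the tail; then `n L^s` has
    -- exponent `e = r/t' + s`. The maximum with `2` keeps the variance bound applicable.
    refine ⟨r / t' + s, by positivity, 2 * c₁ + c * c₂, by positivity,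
      fun L => max 2 ⌈(L : ℝ) ^ (r / t')⌉₊, fun L => le_max_left _ _, fun L hL => ?_⟩
    set m := max 2 ⌈(L : ℝ) ^ (r / t')⌉₊
    have hL1 : (1 : ℝ) ≤ L := by exact_mod_cast hL
    have hL0 : (0 : ℝ) < L := by linarith
    have hy : 1 ≤ (L : ℝ) ^ (r / t') := Real.one_le_rpow hL1 (by positivity)
    have hym : (L : ℝ) ^ (r / t') ≤ m :=
      (Nat.le_ceil _).trans (Nat.cast_le.2 (le_max_right _ _))
    have hmy : (m : ℝ) ≤ 2 * (L : ℝ) ^ (r / t') := by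
      rw [Nat.cast_max, max_le_iff]
      refine ⟨by push_cast; linarith, ?_⟩
      linarith [Nat.ceil_lt_add_one (zero_le_one.trans hy)]
    have hvar : (m : ℝ) ^ (-t') ≤ (L : ℝ) ^ (-r) := by
      calc (m : ℝ) ^ (-t') ≤ ((L : ℝ) ^ (r / t')) ^ (-t') :=
            Real.rpow_le_rpow_of_nonpos (by linarith) hym (by linarith)
        _ = (L : ℝ) ^ (-r) := by
            rw [← Real.rpow_mul hL0.le]
            congr 1
            field_simp
    refine ⟨?_, ?_⟩
    · change 2 * _ + c * ((m : ℝ) ^ (-α) * Real.log m ^ β) ≤ _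
      have hex : (r / t' + s) * rateExponent (α - δ) s (decay γ k a u) ≤ r := by
        calc _ ≤ (r / t' + s) * (t' * r / (t' * s + r)) := by gcongr
          _ = r := by
            have : 0 < t' * s + r := by positivity
            field_simp
            ring
      have hmono : (L : ℝ) ^ (-r) ≤
          (L : ℝ) ^ (-((r / t' + s) * rateExponent (α - δ) s (decay γ k a u))) :=
        Real.rpow_le_rpow_of_exponent_le hL1 (neg_le_neg hex)
      calc _ ≤ 2 * (c₁ * (L : ℝ) ^ (-r)) + c * (c₂ * (L : ℝ) ^ (-r)) := by
            refine add_le_add (mul_le_mul_of_nonneg_left (htail L hL) two_pos.le)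
              (mul_le_mul_of_nonneg_left ?_ hc)
            exact (hlog m (le_max_left _ _)).trans (by gcongr)
        _ = (2 * c₁ + c * c₂) * (L : ℝ) ^ (-r) := by ring
        _ ≤ _ := by gcongr
    · rw [Real.rpow_add hL0, ← mul_assoc]
      gcongr
  -- If `decay_γ = 1` the rate is zero: only boundedness of the error is needed, and two sample
  -- points suffice.
  · have hx : rateExponent (α - δ) s (decay γ k a u) = 0 := by
      rw [← hq, rateExponent, if_neg (by exact EReal.coe_ne_top 1)]
      simp
    refine ⟨s, hs, 2 * (∑' j, hatWeight γ k a (u j)) + c * ((2 : ℝ) ^ (-α) * Real.log 2 ^ β),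
      ?_, fun _ => 2, fun _ => le_rfl, fun L hL => ⟨?_, ?_⟩⟩
    · have h1 : 0 ≤ ∑' j, hatWeight γ k a (u j) := tsum_nonneg fun j => hnn (u j)
      have h2 : 0 ≤ Real.log 2 := Real.log_nonneg one_le_two
      positivity
    · rw [hx, mul_zero, neg_zero, Real.rpow_zero, mul_one]
      have hsu := hu.summable ha
      have : ∑' j, hatWeight γ k a (u (j + L)) ≤ ∑' j, hatWeight γ k a (u j) := by
        rw [← hsu.sum_add_tsum_nat_add L]
        exact le_add_of_nonneg_left (Finset.sum_nonneg fun j _ => hnn _)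
      push_cast
      linarith
    · norm_num

/-- Conversion of bounds in terms of `L` into bounds in terms of the cost. -/
theorem rate_of_bounds {e x b c : ℝ} (he : 0 < e) (hx : 0 ≤ x) (hb : 0 ≤ b) (hc : 0 < c)
    {err2 cost : ℕ → ℝ≥0∞}
    (herr : ∀ L, 1 ≤ L → err2 L ≤ ENNReal.ofReal (b * (L : ℝ) ^ (-(e * x))))
    (hcost : ∀ L, 1 ≤ L → cost L ≤ ENNReal.ofReal (c * (L : ℝ) ^ e)) :
    (∀ L, 1 ≤ L → err2 L ≤ (b * 2 ^ (e * x) * c ^ x).toNNReal * cost L ^ (-x)) ∧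
      ∀ N : ℝ≥0, c.toNNReal ≤ N → ∃ L, 1 ≤ L ∧ cost L ≤ N ∧
        err2 L ≤ (b * 2 ^ (e * x) * c ^ x).toNNReal * (N : ℝ≥0∞) ^ (-x) := by
  refine ⟨fun L hL => ?_, fun N hN => ?_⟩
  · have hL0 : (0 : ℝ) < L := by exact_mod_cast hL
    calc err2 L ≤ ENNReal.ofReal (b * (L : ℝ) ^ (-(e * x))) := herr L hL
      _ ≤ ENNReal.ofReal ((b * 2 ^ (e * x) * c ^ x) * (c * (L : ℝ) ^ e) ^ (-x)) := by
          refine ENNReal.ofReal_le_ofReal ?_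
          have h1 : (c * (L : ℝ) ^ e) ^ (-x) = c ^ (-x) * (L : ℝ) ^ (-(e * x)) := by
            rw [Real.mul_rpow hc.le (by positivity), ← Real.rpow_mul hL0.le, mul_neg]
          have h2 : c ^ x * c ^ (-x) = 1 := by rw [← Real.rpow_add hc]; simp
          have h3 : (1 : ℝ) ≤ 2 ^ (e * x) := Real.one_le_rpow one_le_two (by positivity)
          calc b * (L : ℝ) ^ (-(e * x)) ≤ b * (L : ℝ) ^ (-(e * x)) * 2 ^ (e * x) :=
                le_mul_of_one_le_right (by positivity) h3
            _ = b * 2 ^ (e * x) * (c ^ x * c ^ (-x)) * (L : ℝ) ^ (-(e * x)) := by rw [h2]; ring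
            _ = _ := by rw [h1]; ring
      _ = (b * 2 ^ (e * x) * c ^ x).toNNReal * ENNReal.ofReal (c * (L : ℝ) ^ e) ^ (-x) := by
          rw [ENNReal.ofReal_mul (by positivity), ENNReal.ofReal_rpow_of_pos (by positivity)]
          rfl
      _ ≤ _ := by
          refine mul_le_mul_right ?_ _
          rw [ENNReal.rpow_neg, ENNReal.rpow_neg, ENNReal.inv_le_inv]
          exact ENNReal.rpow_le_rpow (hcost L hL) hx
  · have hcN : c ≤ N := (Real.toNNReal_le_iff_le_coe).1 hN
    have hN0 : (0 : ℝ) < N := hc.trans_le hcN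
    -- `y` solves `c y^e = N`, and `L = ⌊y⌋` is affordable. Since `y ≥ 1`, rounding loses at most a
    -- factor two, the source of `2 ^ (e * x)`.
    set y := ((N : ℝ) / c) ^ (1 / e)
    have hNc : 1 ≤ (N : ℝ) / c := (one_le_div hc).2 hcN
    have hy1 : 1 ≤ y := Real.one_le_rpow hNc (by positivity)
    have hye : y ^ e = (N : ℝ) / c := by
      rw [← Real.rpow_mul (by positivity), one_div_mul_cancel he.ne', Real.rpow_one]
    clear_value y
    have hL1 : 1 ≤ ⌊y⌋₊ := Nat.le_floor (by simpa using hy1)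
    have hL1' : (1 : ℝ) ≤ ⌊y⌋₊ := by exact_mod_cast hL1
    have hLy : (⌊y⌋₊ : ℝ) ≤ y := Nat.floor_le (by linarith)
    have hyL : y / 2 ≤ ⌊y⌋₊ := by linarith [Nat.lt_floor_add_one y]
    refine ⟨⌊y⌋₊, hL1, (hcost _ hL1).trans ?_, (herr _ hL1).trans ?_⟩
    · rw [← ENNReal.ofReal_coe_nnreal]
      refine ENNReal.ofReal_le_ofReal ?_
      calc c * (⌊y⌋₊ : ℝ) ^ e ≤ c * y ^ e := by gcongr
        _ = N := by rw [hye, mul_div_cancel₀ _ hc.ne']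
    · rw [← ENNReal.ofReal_coe_nnreal (p := N), ENNReal.ofReal_rpow_of_pos hN0]
      change _ ≤ ENNReal.ofReal _ * _
      rw [← ENNReal.ofReal_mul (by positivity)]
      refine ENNReal.ofReal_le_ofReal ?_
      calc b * (⌊y⌋₊ : ℝ) ^ (-(e * x)) ≤ b * (y / 2) ^ (-(e * x)) := by
            refine mul_le_mul_of_nonneg_left ?_ hb
            refine Real.rpow_le_rpow_of_nonpos (by linarith) hyL ?_
            have := mul_nonneg he.le hx
            linarith
        _ = b * ((y ^ e) ^ (-x) * 2 ^ (e * x)) := by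
            rw [Real.div_rpow (by linarith) two_pos.le, ← Real.rpow_mul (by linarith), mul_neg,
              Real.rpow_neg two_pos.le, div_inv_eq_mul]
        _ = _ := by
            rw [hye, Real.div_rpow hN0.le hc.le, Real.rpow_neg hc.le, div_inv_eq_mul]
            ring

end InfDimIntegration

/-! ### Assembly of the error, sample size and cost bounds -/

theorem mainTheorem9
    -- the integration problem: the probability space `(D, ρ)`, `D ⊆ ℝ`, kernel and weights
    {D : Set ℝ} (ρ : Measure D) [IsProbabilityMeasure ρ] (k : D → D → ℝ) [IsReproducingKernel k]
    (γ : Finset ℕ → ℝ≥0) (hA : StandingAssumptions ρ k γ) (hγ : IsFiniteIntersection γ)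
    -- the anchor and the decreasing ordering of the nonempty active sets
    (a : D) (ha : Summable fun w : Finset ℕ => (γ w : ℝ) * k a a ^ w.card)
    (u : ℕ → Finset ℕ) (hu : IsWeightOrdering γ k a u)
    -- the dimension `d = η (o - 1) + 1`
    (o η d : ℕ) (ho : HasFiniteOrder γ o) (hη : HasCoordinateBound γ η)
    (hd : d = η * (o - 1) + 1)
    -- the cost function
    (cost : ℕ → ℝ≥0) (hcost : Monotone cost) (s : ℝ) (hs : 0 < s)
    (hcost_s : (fun ν : ℕ => (cost ν : ℝ)) =O[atTop] fun ν : ℕ => (ν : ℝ) ^ s)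
    -- the probability space underlying the randomization
    {Ω : Type*} [MeasurableSpace Ω] (P : Measure Ω) [IsProbabilityMeasure P]
    (α β Cd δ : ℝ) (hδ : 0 < δ) (hδα : δ < α) :
    (∃ φ : ℕ → Fin d, IsInjectiveOnActive γ φ) ∧
    ∃ (C N₀ : ℝ≥0) (n : ℕ → ℕ), (∀ L, 1 ≤ n L) ∧
      ∀ Q : ∀ n : ℕ, RandomRule (Fin d → Ω) (Fin d → D) n,
        RuleAssumptions P ρ k d α β Cd Q →
      ∀ φ : ℕ → Fin d, IsInjectiveOnActive γ φ →
        let P' : Measure (Fin d → Ω) := Measure.pi fun _ => P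
        let v : ℕ → Finset ℕ := activeUnion u
        -- the single-level algorithm for `v = u₁ ∪ … ∪ u_L` with `n L` sample points
        let alg : (L : ℕ) → RandomRule (Fin d → Ω) (ℕ → D) (n L) :=
          fun L => (Q (n L)).replicate φ (v L) a
        let algCost : ℕ → ℝ≥0∞ := fun L => (alg L).expectedCost P' (fixedCost cost (v L) a)
        let err : ℕ → ℝ≥0∞ := fun L => (alg L).error P' ρ (unitBall (weightedKernel γ k))
        let x : ℝ := rateExponent (α - δ) s (decay γ k a u)
        (∀ L, 1 ≤ L → err L ^ 2 ≤ C * algCost L ^ (-x)) ∧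
        ∀ N : ℝ≥0, N₀ ≤ N →
          ∃ L, 1 ≤ L ∧ algCost L ≤ N ∧ err L ^ 2 ≤ C * (N : ℝ≥0∞) ^ (-x) := by
  have hk := hA.diag_pos a
  refine ⟨hd ▸ exists_isInjectiveOnActive ho hη, ?_⟩
  set S := max 1 (k a a)⁻¹ ^ o * ∑' w : Finset ℕ, (γ w : ℝ) * k a a ^ w.card with hS
  have hS0 : 0 ≤ S := mul_nonneg (by positivity) (tsum_nonneg fun w => by positivity)
  obtain ⟨e, he, b, hb, n, hn, hbound⟩ := exists_sampleSize (α := α) (β := β) (δ := δ) (s := s)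
    (c := 2 * S * |Cd|) hk hu ha hδ hδα hs (by positivity)
  obtain ⟨c, hc, hcle⟩ := exists_cost_le hcost hs hcost_s
  have hx := rateExponent_nonneg (t := α - δ) (s := s) (by linarith) hs.le (one_le_decay hk hu ha)
  -- `C` and `N₀` are those of `rate_of_bounds`; they involve only `b`, `e`, `c`, `o`, `s` and the
  -- rate, all fixed before `Q` and `φ` are introduced.
  refine ⟨_, _, n, fun L => one_le_two.trans (hn L), fun Q hQ φ hφ =>
    rate_of_bounds (c := 2 * c * ((o : ℝ) + 1) ^ s) he hx hb (by positivity)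
      (fun L hL => ?_) fun L hL => ?_⟩
  · refine (sq_error_replicate_le hA hu ha ho hη hQ (hn L) hφ L).trans
      (ENNReal.ofReal_le_ofReal (le_of_eq_of_le ?_ (hbound L hL).1))
    rw [← hS]
    ring
  · rw [expectedCost_replicate, ← ENNReal.ofReal_natCast, ← ENNReal.ofReal_coe_nnreal,
      ← ENNReal.ofReal_mul (Nat.cast_nonneg _)]
    refine ENNReal.ofReal_le_ofReal ?_
    have hL1 : (1 : ℝ) ≤ L := by exact_mod_cast hL
    -- The additive `1` is absorbed using `L ≥ 1`.
    have hcard : ((activeUnion u L).card : ℝ) + 1 ≤ ((o : ℝ) + 1) * L := by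
      have : ((activeUnion u L).card : ℝ) ≤ L * o := by
        exact_mod_cast card_activeUnion_le hu ho L
      linarith
    calc (n L : ℝ) * cost (activeUnion u L).card
        ≤ n L * (c * (((o : ℝ) + 1) * L) ^ s) := by
          gcongr
          exact (hcle _).trans (by gcongr)
      _ = c * ((o : ℝ) + 1) ^ s * (n L * (L : ℝ) ^ s) := by
          rw [Real.mul_rpow (by positivity) (by positivity)]
          ring
      _ ≤ c * ((o : ℝ) + 1) ^ s * (2 * (L : ℝ) ^ e) := by
          exact mul_le_mul_of_nonneg_left (hbound L hL).2 (by positivity)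
      _ = _ := by ring
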